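/- Let $n,p\ge 1$ and let $M$ be a complete smooth Riemannian manifold of dimension $n+p$ and of constant sectional curvature $c\ge 0$, with Levi-Civita connection $\nabla$. Let $\mathcal F$ and $\mathcal F^\perp$ be two mutually orthogonal $C^\infty$ foliations of $M$ with leaves of dimension $n$ and $p$ respectively. For a vector field $X$ put $\mathrm{div}_{\mathcal F}(X)=\sum_{i=1}^n\langle e_i,\nabla_{e_i}X\rangle$, and let $h^\perp=\frac1p\sum_{\alpha=n+1}^{n+p}(\nabla_{e_\alpha}e_\alpha)^\top$ be the (normalized) mean curvature vector of the leaves of $\mathcal F^\perp$, where $e_1,\dots,e_n$ and $e_{n+1},\dots,e_{n+p}$ are local orthonormal frames tangent to $\mathcal F$ and to $\mathcal F^\perp$, and $\top$ denotes the component tangent to $\mathcal F$. Suppose that 1. either $p\ge 2$ and every leaf of $\mathcal F^\perp$ is totally umbilical, or $p=1$ and $\mathcal F^\perp$ is a foliation by round circles, i.e. every local smooth unit vector field $T$ tangent to $\mathcal F^\perp$ satisfies $\nabla_T\nabla_T T=-\|\nabla_T T\|^2\,T$ (geodesics are allowed); 2. $\|h^\perp\|$ is bounded on $M$ and attains its maximum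 over $M$ at a point of a leaf $L^\perp$ of $\mathcal F^\perp$; 3. $\mathrm{div}_{\mathcal F}(h^\perp)(x)\le nc$ for all $x\in L^\perp$. Then $c=0$, all leaves of $\mathcal F$ and of $\mathcal F^\perp$ are totally geodesic, and $M$ is locally a Riemannian product of a leaf of $\mathcal F$ and a leaf of $\mathcal F^\perp$: every point $x\in M$ has an open neighbourhood that is isometric to the Riemannian product of open pieces of the leaves of $\mathcal F$ and $\mathcal F^\perp$ through $x$, in such a way that the slices of the product correspond to pieces of leaves of $\mathcal F$ and $\mathcal F^\perp$. -/

import Mathlib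

open scoped Manifold ContDiff Bundle Topology

noncomputable section

section LeviCivita

variable {E : Type*} [NormedAddCommGroup E] [NormedSpace ℝ E] [FiniteDimensional ℝ E]
  {M : Type*} [TopologicalSpace M] [ChartedSpace E M]

instance tangentSpace_finiteDimensional (x : M) :
    FiniteDimensional ℝ (TangentSpace 𝓘(ℝ, E) x) :=
  inferInstanceAs (FiniteDimensional ℝ E)

variable [IsManifold 𝓘(ℝ, E) ∞ M]
  [Bundle.RiemannianBundle (fun x : M => TangentSpace 𝓘(ℝ, E) x)]

/-- Half of the right-hand side of the Koszul formula: for differentiable vector fields this is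
`⟨∇_X Y, Z⟩`, where `∇` is the Levi-Civita connection. -/
def koszul (X Y Z : Π x : M, TangentSpace 𝓘(ℝ, E) x) (x : M) : ℝ :=
  (1 / 2 : ℝ) *
    (mvfderiv 𝓘(ℝ, E) (fun y => inner ℝ (Y y) (Z y)) x (X x)
      + mvfderiv 𝓘(ℝ, E) (fun y => inner ℝ (Z y) (X y)) x (Y x)
      - mvfderiv 𝓘(ℝ, E) (fun y => inner ℝ (X y) (Y y)) x (Z x)
      + inner ℝ (VectorField.mlieBracket 𝓘(ℝ, E) X Y x) (Z x)
      - inner ℝ (VectorField.mlieBracket 𝓘(ℝ, E) Y Z x) (X x)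
      + inner ℝ (VectorField.mlieBracket 𝓘(ℝ, E) Z X x) (Y x))

/-- The Levi-Civita covariant derivative `∇_u Y` at `x` of a vector field `Y` (differentiable
at `x`) in the direction of the tangent vector `u`. It is the vector that represents the Koszul
functional, which is tensorial in its first and third arguments, so that arbitrary smooth local
extensions of `u` and of the vectors of an orthonormal basis may be used. -/
def leviCivita (Y : Π x : M, TangentSpace 𝓘(ℝ, E) x) (x : M) (u : TangentSpace 𝓘(ℝ, E) x) :
    TangentSpace 𝓘(ℝ, E) x :=
  let b := stdOrthonormalBasis ℝ (TangentSpace 𝓘(ℝ, E) x)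
  ∑ i, koszul (FiberBundle.extend E u) Y (FiberBundle.extend E (b i)) x • b i

/-- The curvature `R(X, Y) Z = ∇_X ∇_Y Z - ∇_Y ∇_X Z - ∇_[X, Y] Z`. -/
def curvature (X Y Z : Π x : M, TangentSpace 𝓘(ℝ, E) x) (x : M) : TangentSpace 𝓘(ℝ, E) x :=
  leviCivita (fun y => leviCivita Z y (Y y)) x (X x)
    - leviCivita (fun y => leviCivita Z y (X y)) x (Y x)
    - leviCivita Z x (VectorField.mlieBracket 𝓘(ℝ, E) X Y x)

/-- A vector field that is smooth near `x`. -/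
def SmoothFieldAt (X : Π x : M, TangentSpace 𝓘(ℝ, E) x) (x : M) : Prop :=
  ContMDiffAt 𝓘(ℝ, E) (𝓘(ℝ, E).prod 𝓘(ℝ, E)) ∞
    (fun y => (⟨y, X y⟩ : TangentBundle 𝓘(ℝ, E) M)) x

variable (E M) in
/-- All sectional curvatures of `M` are equal to `c`. -/
def HasConstantCurvature (c : ℝ) : Prop :=
  ∀ (x : M) (X Y : Π x : M, TangentSpace 𝓘(ℝ, E) x), SmoothFieldAt X x → SmoothFieldAt Y x →
    inner ℝ (curvature X Y Y x) (X x) = c * (‖X x‖ ^ 2 * ‖Y x‖ ^ 2 - inner ℝ (X x) (Y x) ^ 2)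

end LeviCivita

/-- A smooth foliation of `M` with leaves of dimension `k` and codimension `q`, given by its
tangent spaces: around each point there is a smooth chart with values in `ℝᵏ × ℝ^q` in which the
tangent spaces of the foliation are the tangent spaces of the slices `ℝᵏ × {pt}`. -/
structure Foliation (E : Type*) [NormedAddCommGroup E] [NormedSpace ℝ E]
    (M : Type*) [TopologicalSpace M] [ChartedSpace E M] (k q : ℕ) where
  /-- The tangent space at `x` of the leaf through `x`. -/
  tangent : Π x : M, Submodule ℝ (TangentSpace 𝓘(ℝ, E) x)
  exists_chart : ∀ x : M,
    ∃ φ : OpenPartialHomeomorph M (EuclideanSpace ℝ (Fin k) × EuclideanSpace ℝ (Fin q)),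
      x ∈ φ.source ∧
      ContMDiffOn 𝓘(ℝ, E) 𝓘(ℝ, EuclideanSpace ℝ (Fin k) × EuclideanSpace ℝ (Fin q)) ∞
        φ φ.source ∧
      ContMDiffOn 𝓘(ℝ, EuclideanSpace ℝ (Fin k) × EuclideanSpace ℝ (Fin q)) 𝓘(ℝ, E) ∞
        φ.symm φ.target ∧
      ∀ y ∈ φ.source, ∀ v : TangentSpace 𝓘(ℝ, E) y, v ∈ tangent y ↔
        (mfderiv 𝓘(ℝ, E) 𝓘(ℝ, EuclideanSpace ℝ (Fin k) × EuclideanSpace ℝ (Fin q)) φ y v :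
          EuclideanSpace ℝ (Fin k) × EuclideanSpace ℝ (Fin q)).2 = 0

namespace Foliation

variable {E : Type*} [NormedAddCommGroup E] [NormedSpace ℝ E] [FiniteDimensional ℝ E]
  {M : Type*} [TopologicalSpace M] [ChartedSpace E M] {k q : ℕ}

/-- The leaf through `x`: all points that are joined to `x` by a smooth curve which is
everywhere tangent to the foliation. -/
def leaf (F : Foliation E M k q) (x : M) : Set M :=
  {y | ∃ γ : ℝ → M, ContMDiff 𝓘(ℝ, ℝ) 𝓘(ℝ, E) ∞ γ ∧
    (∀ t : ℝ, mfderiv 𝓘(ℝ, ℝ) 𝓘(ℝ, E) γ t (1 : ℝ) ∈ F.tangent (γ t)) ∧ γ 0 = x ∧ γ 1 = y}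

variable [IsManifold 𝓘(ℝ, E) ∞ M]
  [Bundle.RiemannianBundle (fun x : M => TangentSpace 𝓘(ℝ, E) x)]

/-- The second fundamental form of the leaves: the normal component of `∇_u V` at `x`, where `V`
is a vector field tangent to the foliation with `V x = v` (for `v` tangent to the foliation). -/
def secondFundamentalForm (F : Foliation E M k q) (x : M) (u v : TangentSpace 𝓘(ℝ, E) x) :
    TangentSpace 𝓘(ℝ, E) x :=
  (F.tangent x)ᗮ.starProjection
    (leviCivita (fun y => (F.tangent y).starProjection (FiberBundle.extend E v y)) x u)

/-- The normalized mean curvature vector `(1/k) ∑ᵢ (∇_{eᵢ} eᵢ)^⊥` of the leaves. -/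
def meanCurvature (F : Foliation E M k q) (x : M) : TangentSpace 𝓘(ℝ, E) x :=
  let b := stdOrthonormalBasis ℝ (F.tangent x)
  (k : ℝ)⁻¹ • ∑ i, F.secondFundamentalForm x (b i) (b i)

/-- The divergence `∑ᵢ ⟨eᵢ, ∇_{eᵢ} X⟩` along the foliation. -/
def divergence (F : Foliation E M k q) (X : Π x : M, TangentSpace 𝓘(ℝ, E) x) (x : M) : ℝ :=
  let b := stdOrthonormalBasis ℝ (F.tangent x)
  ∑ i, inner ℝ (b i : TangentSpace 𝓘(ℝ, E) x) (leviCivita X x (b i))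

/-- Every leaf is a totally geodesic submanifold. -/
def IsTotallyGeodesic (F : Foliation E M k q) : Prop :=
  ∀ (x : M), ∀ u ∈ F.tangent x, ∀ v ∈ F.tangent x, F.secondFundamentalForm x u v = 0

/-- Every leaf is a totally umbilical submanifold. -/
def IsTotallyUmbilical (F : Foliation E M k q) : Prop :=
  ∀ (x : M), ∀ u ∈ F.tangent x, ∀ v ∈ F.tangent x,
    F.secondFundamentalForm x u v = (inner ℝ u v : ℝ) • F.meanCurvature x

/-- For a one-dimensional foliation: every leaf is a circle of the Riemannian manifold, that is,
its unit tangent field `T` satisfies `∇_T ∇_T T = -κ² T` with `κ = ‖∇_T T‖` (this equation forces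
`κ` to be constant along each leaf). Geodesics count as circles of curvature zero. -/
def IsByRoundCircles (F : Foliation E M k q) : Prop :=
  ∀ (x : M) (T : Π x : M, TangentSpace 𝓘(ℝ, E) x), SmoothFieldAt T x →
    (∀ᶠ y in 𝓝 x, T y ∈ F.tangent y ∧ ‖T y‖ = 1) →
      leviCivita (fun y => leviCivita T y (T y)) x (T x) = -(‖leviCivita T x (T x)‖ ^ 2) • T x

/-- `M` is locally a Riemannian product of a leaf of `F` and a leaf of `G`: every point `x` has
an open neighbourhood with a diffeomorphism `φ` onto a product `A × B` of open sets such that, for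
`(a₀, b₀) = φ x`, the slices `A × {b}` and `{a} × B` correspond to open pieces of leaves of `F`
and of `G`, and the metric is the sum of the metrics induced on the pieces `A × {b₀}` and
`{a₀} × B` of the leaves through `x`. -/
def IsLocallyRiemannianProduct (F : Foliation E M k q) (G : Foliation E M q k) : Prop :=
  ∀ x : M, ∃ (φ : OpenPartialHomeomorph M (EuclideanSpace ℝ (Fin k) × EuclideanSpace ℝ (Fin q)))
    (A : Set (EuclideanSpace ℝ (Fin k))) (B : Set (EuclideanSpace ℝ (Fin q)))
    (a₀ : EuclideanSpace ℝ (Fin k)) (b₀ : EuclideanSpace ℝ (Fin q)),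
    x ∈ φ.source ∧ φ x = (a₀, b₀) ∧ IsOpen A ∧ IsOpen B ∧ φ.target = A ×ˢ B ∧
    ContMDiffOn 𝓘(ℝ, E) 𝓘(ℝ, EuclideanSpace ℝ (Fin k) × EuclideanSpace ℝ (Fin q)) ∞
      φ φ.source ∧
    ContMDiffOn 𝓘(ℝ, EuclideanSpace ℝ (Fin k) × EuclideanSpace ℝ (Fin q)) 𝓘(ℝ, E) ∞
      φ.symm φ.target ∧
    ∀ a ∈ A, ∀ b ∈ B,
      φ.symm (a, b) ∈ F.leaf (φ.symm (a₀, b)) ∧ φ.symm (a, b) ∈ G.leaf (φ.symm (a, b₀)) ∧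
      ∀ (u : EuclideanSpace ℝ (Fin k)) (v : EuclideanSpace ℝ (Fin q)),
        let D := fun (z w : EuclideanSpace ℝ (Fin k) × EuclideanSpace ℝ (Fin q)) =>
          mfderiv 𝓘(ℝ, EuclideanSpace ℝ (Fin k) × EuclideanSpace ℝ (Fin q)) 𝓘(ℝ, E) φ.symm z w
        D (a, b) (u, 0) ∈ F.tangent (φ.symm (a, b)) ∧
        D (a, b) (0, v) ∈ G.tangent (φ.symm (a, b)) ∧
        ‖D (a, b) (u, v)‖ ^ 2 = ‖D (a, b₀) (u, 0)‖ ^ 2 + ‖D (a₀, b) (0, v)‖ ^ 2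

end Foliation

end

/-!
Let `h` be the mean curvature vector of the leaves of `G`, and `Z = ∑ᵢ (∇_{eᵢ} eᵢ)^⊥` the
unnormalized mean curvature vector of the leaves of `F`, a field tangent to `G`. If the leaves of
`G` are totally umbilical, which is automatic when they are curves
(`Foliation.isTotallyUmbilical_of_dim_one`), then summing the sectional curvatures of the mixed
planes spanned by `eᵢ` and a vector `T` tangent to `G` gives, with `S` the second fundamental form
of `F`,

  `n c |T|² = |T|² (div_F h - |h|²) + ⟨T, ∇_T Z⟩ - ∑ᵢⱼ ⟨T, S(eᵢ, eⱼ)⟩²`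

(`Foliation.mixed_curvature_identity`). Where `div_F h ≤ n c`, taking `T = Z` and applying the
Cauchy-Schwarz inequality to `|Z|² = ∑ᵢ ⟨Z, S(eᵢ, eᵢ)⟩` turns this into the Riccati inequality
`|Z|⁴ ≤ n ⟨Z, ∇_Z Z⟩` (`Foliation.riccati_totalMeanCurvature`).

Completeness enters through the field `Z / √(1 + |Z|²)`. Its length is at most one, so its integral
curves are Lipschitz and exist for all positive times; being tangent to `G`, they stay in a leaf of
`G`. On a leaf of `G` with `div_F h ≤ n c` the Riccati inequality holds along these curves, and
`|Z|` would blow up in finite time unless it vanishes at the initial point. Hence `Z = 0` on the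
whole leaf (`Foliation.totalMeanCurvature_eq_zero`), so `∇_T Z = 0` for `T` tangent to `G`, and in
the identity above all remaining terms have the same sign: `S = 0`, `h = 0` and `div_F h = n c` at
every point of the leaf (`Foliation.rigidity_of_parallel`).

On the leaf through the point where `|h|` is maximal this says that the maximum is zero. So `h`
vanishes identically, `div_F h = 0 ≤ n c` holds everywhere, and the same argument applies to every
leaf of `G`: `F` is totally geodesic and `n c = div_F h = 0`. Umbilical leaves with vanishing mean
curvature are totally geodesic, which settles `G` (`Foliation.totallyGeodesic_of_divergence_le`).

For the local product structure, the transverse coordinates of foliation charts of `F` and `G`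
together form a chart in which the leaves of both are coordinate slices
(`Foliation.exists_product_chart`). Coordinate fields commute, and if `X` is tangent to a totally
geodesic foliation and commutes with a normal field `Y`, then
`Y |X|² = 2 ⟨∇_X Y, X⟩ = -2 ⟨Y, ∇_X X⟩ = 0`. Thus the metric coefficients of each factor do not
depend on the coordinates of the other (`Foliation.IsTotallyGeodesic.norm_mfderiv_symm_eq`), and the
metric is a product (`Foliation.isLocallyRiemannianProduct`).

Vector fields are handled pointwise: `SmoothFieldAt X x` for all `x` is smoothness of `X`, and
functions are differentiated with `mvfderiv`. The Levi-Civita connection is the one given by the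
Koszul formula; its linearity, Leibniz rule, metric compatibility and torsion-freeness are derived
from the tensoriality of the Koszul functional.
-/

set_option linter.unusedSectionVars false

/-! ### The Levi-Civita connection -/

section LeviCivitaTheory

open VectorField FiberBundle

variable {E : Type*} [NormedAddCommGroup E] [NormedSpace ℝ E] [FiniteDimensional ℝ E]
  {M : Type*} [TopologicalSpace M] [ChartedSpace E M] [IsManifold 𝓘(ℝ, E) ∞ M]

namespace SmoothFieldAt

variable {X Y : Π x : M, TangentSpace 𝓘(ℝ, E) x} {x : M}

theorem mdifferentiableAt (hX : SmoothFieldAt X x) : MDiffAt (T% X) x :=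
  ContMDiffAt.mdifferentiableAt hX (by simp)

theorem eventually_mdifferentiableAt (hX : SmoothFieldAt X x) :
    ∀ᶠ y in 𝓝 x, MDiffAt (T% X) y := by
  have h1 : CMDiffAt 1 (T% X) x := ContMDiffAt.of_le hX (by simp)
  filter_upwards [(contMDiffAt_iff_contMDiffAt_nhds (by simp)).1 h1] with y hy
  exact ContMDiffAt.mdifferentiableAt hy (by simp)

theorem congr (hX : SmoothFieldAt X x) (h : ∀ᶠ y in 𝓝 x, Y y = X y) : SmoothFieldAt Y x :=
  ContMDiffAt.congr_of_eventuallyEq hX (h.mono fun y hy => by simp [hy])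

theorem add (hX : SmoothFieldAt X x) (hY : SmoothFieldAt Y x) :
    SmoothFieldAt (fun y => X y + Y y) x :=
  ContMDiffAt.add_section hX hY

theorem sub (hX : SmoothFieldAt X x) (hY : SmoothFieldAt Y x) :
    SmoothFieldAt (fun y => X y - Y y) x :=
  ContMDiffAt.sub_section hX hY

theorem smul {f : M → ℝ} (hf : CMDiffAt ∞ f x) (hX : SmoothFieldAt X x) :
    SmoothFieldAt (fun y => f y • X y) x :=
  ContMDiffAt.smul_section hf hX

theorem const_smul (a : ℝ) (hX : SmoothFieldAt X x) : SmoothFieldAt (fun y => a • X y) x :=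
  ContMDiffAt.const_smul_section hX

theorem sum {ι : Type*} {s : Finset ι} {X : ι → Π x : M, TangentSpace 𝓘(ℝ, E) x}
    (hX : ∀ i ∈ s, SmoothFieldAt (X i) x) : SmoothFieldAt (fun y => ∑ i ∈ s, X i y) x :=
  ContMDiffAt.sum_section hX

theorem mlieBracket (hX : SmoothFieldAt X x) (hY : SmoothFieldAt Y x) :
    SmoothFieldAt (mlieBracket 𝓘(ℝ, E) X Y) x := by
  have : IsManifold 𝓘(ℝ, E) (((⊤ : ℕ∞) : WithTop ℕ∞) + 1) M := ‹_›
  have : IsManifold 𝓘(ℝ, E) (minSmoothness ℝ 2) M := by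
    rw [minSmoothness_of_isRCLikeNormedField]; infer_instance
  have : IsManifold 𝓘(ℝ, E) (minSmoothness ℝ 3) M := by
    rw [minSmoothness_of_isRCLikeNormedField]; infer_instance
  exact ContMDiffAt.mlieBracket_vectorField (m := ⊤) (n := ⊤) hX hY (by simp)

/-- The derivative of a smooth function along a smooth vector field is smooth. -/
theorem mvfderiv_apply {f : M → ℝ} (hf : CMDiffAt ∞ f x) (hX : SmoothFieldAt X x) :
    CMDiffAt ∞ (fun y => mvfderiv 𝓘(ℝ, E) f y (X y)) x := by
  have h1 := hf.mfderiv_const (m := ∞) (by simp)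
  have h2 : ContMDiffAt 𝓘(ℝ, E) 𝓘(ℝ, ℝ).tangent ∞
      (fun y => (⟨f y, mfderiv 𝓘(ℝ, E) 𝓘(ℝ, ℝ) f y (X y)⟩ : TangentBundle 𝓘(ℝ, ℝ) ℝ)) x :=
    ContMDiffAt.clm_apply_of_inCoordinates h1 hX hf
  exact (contMDiff_snd_tangentBundle_modelSpace ℝ 𝓘(ℝ, ℝ)).contMDiffAt.comp x h2

end SmoothFieldAt

theorem Filter.EventuallyEq.mvfderiv_eq {f g : M → ℝ} {x : M} (h : f =ᶠ[𝓝 x] g) :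
    mvfderiv 𝓘(ℝ, E) f x = mvfderiv 𝓘(ℝ, E) g x := by
  ext v
  simp only [mvfderiv, ContinuousLinearMap.comp_apply, h.mfderiv_eq]
  rfl

theorem smoothFieldAt_extend {x : M} (v : TangentSpace 𝓘(ℝ, E) x) :
    SmoothFieldAt (extend E v) x :=
  contMDiffAt_extend 𝓘(ℝ, E) E v

variable [Bundle.RiemannianBundle (fun x : M => TangentSpace 𝓘(ℝ, E) x)]
  [IsContMDiffRiemannianBundle 𝓘(ℝ, E) ∞ E (fun x : M => TangentSpace 𝓘(ℝ, E) x)]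
  {X Y Z : Π x : M, TangentSpace 𝓘(ℝ, E) x} {x : M}

theorem SmoothFieldAt.contMDiffAt_inner (hX : SmoothFieldAt X x) (hY : SmoothFieldAt Y x) :
    CMDiffAt ∞ (fun y => (inner ℝ (X y) (Y y) : ℝ)) x :=
  ContMDiffAt.inner_bundle hX hY

theorem mdifferentiableAt_inner (hX : MDiffAt (T% X) x) (hY : MDiffAt (T% Y) x) :
    MDiffAt (fun y => (inner ℝ (X y) (Y y) : ℝ)) x :=
  MDifferentiableAt.inner_bundle hX hY

/-- The Koszul functional is tensorial in its first argument. -/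
theorem tensorialAt_koszul_left (hY : MDiffAt (T% Y) x) (hZ : MDiffAt (T% Z) x) :
    TensorialAt 𝓘(ℝ, E) E (fun X => koszul X Y Z x) x where
  smul {f X} hf hX := by
    have h1 := mvfderiv_fun_mul hf (mdifferentiableAt_inner hZ hX)
    have h2 := mvfderiv_fun_mul hf (mdifferentiableAt_inner hX hY)
    simp only [koszul, Pi.smul_apply', real_inner_smul_left, real_inner_smul_right,
      mlieBracket_smul_left hf hX, mlieBracket_smul_right hf hX, inner_add_left, h1, h2,
      map_smul, smul_eq_mul, add_apply, smul_apply,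
      real_inner_comm (X x) (Z x)]
    ring
  add {X X'} hX hX' := by
    have h1 := mvfderiv_fun_add (mdifferentiableAt_inner hZ hX) (mdifferentiableAt_inner hZ hX')
    have h2 := mvfderiv_fun_add (mdifferentiableAt_inner hX hY) (mdifferentiableAt_inner hX' hY)
    simp only [koszul, Pi.add_apply, inner_add_left, inner_add_right, h1, h2,
      mlieBracket_add_left hX hX', mlieBracket_add_right hX hX', map_add,
      add_apply]
    ring

/-- The Koszul functional is tensorial in its third argument. -/
theorem tensorialAt_koszul_right (hX : MDiffAt (T% X) x) (hY : MDiffAt (T% Y) x) :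
    TensorialAt 𝓘(ℝ, E) E (fun Z => koszul X Y Z x) x where
  smul {f Z} hf hZ := by
    have h1 := mvfderiv_fun_mul hf (mdifferentiableAt_inner hZ hX)
    have h2 := mvfderiv_fun_mul hf (mdifferentiableAt_inner hY hZ)
    simp only [koszul, Pi.smul_apply', real_inner_smul_left, real_inner_smul_right,
      mlieBracket_smul_left hf hZ, mlieBracket_smul_right hf hZ, inner_add_left, h1, h2,
      map_smul, smul_eq_mul, add_apply, smul_apply,
      real_inner_comm (Z x) (Y x)]
    ring
  add {Z Z'} hZ hZ' := by
    have h1 := mvfderiv_fun_add (mdifferentiableAt_inner hZ hX) (mdifferentiableAt_inner hZ' hX)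
    have h2 := mvfderiv_fun_add (mdifferentiableAt_inner hY hZ) (mdifferentiableAt_inner hY hZ')
    simp only [koszul, Pi.add_apply, inner_add_left, inner_add_right, h1, h2,
      mlieBracket_add_left hZ hZ', mlieBracket_add_right hZ hZ', map_add,
      add_apply]
    ring

/-- The Koszul formula: the vector `leviCivita Y x u` represents the Koszul functional. -/
theorem inner_leviCivita (hX : MDiffAt (T% X) x) (hY : MDiffAt (T% Y) x)
    (hZ : MDiffAt (T% Z) x) :
    inner ℝ (leviCivita Y x (X x)) (Z x) = koszul X Y Z x := by
  have hU : MDiffAt (T% (extend E (X x))) x := mdifferentiableAt_extend ..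
  have hT := tensorialAt_koszul_right hU hY
  rw [(tensorialAt_koszul_left hY hZ).pointwise hX hU (by simp),
    ← TensorialAt.mkHom_apply hT hZ]
  conv_rhs => rw [← (stdOrthonormalBasis ℝ (TangentSpace 𝓘(ℝ, E) x)).sum_repr' (Z x)]
  simp only [leviCivita, sum_inner, real_inner_smul_left, map_sum, map_smul, smul_eq_mul,
    TensorialAt.mkHom_apply_eq_extend]
  exact Finset.sum_congr rfl fun i _ => mul_comm _ _

theorem inner_leviCivita_vec (u w : TangentSpace 𝓘(ℝ, E) x) (hY : MDiffAt (T% Y) x) :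
    inner ℝ (leviCivita Y x u) w = koszul (extend E u) Y (extend E w) x := by
  have := inner_leviCivita (X := extend E u) (Z := extend E w) (mdifferentiableAt_extend ..) hY
    (mdifferentiableAt_extend ..)
  simpa using this

theorem leviCivita_add_right (hY : MDiffAt (T% Y) x) (u v : TangentSpace 𝓘(ℝ, E) x) :
    leviCivita Y x (u + v) = leviCivita Y x u + leviCivita Y x v := by
  refine ext_inner_right ℝ fun w => ?_
  have h := tensorialAt_koszul_left hY (mdifferentiableAt_extend 𝓘(ℝ, E) E w)
  simp only [inner_add_left, inner_leviCivita_vec _ _ hY, ← h.mkHom_apply_eq_extend, map_add]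

theorem leviCivita_smul_right (hY : MDiffAt (T% Y) x) (a : ℝ) (u : TangentSpace 𝓘(ℝ, E) x) :
    leviCivita Y x (a • u) = a • leviCivita Y x u := by
  refine ext_inner_right ℝ fun w => ?_
  have h := tensorialAt_koszul_left hY (mdifferentiableAt_extend 𝓘(ℝ, E) E w)
  simp only [real_inner_smul_left, inner_leviCivita_vec _ _ hY, ← h.mkHom_apply_eq_extend,
    map_smul, smul_eq_mul]

/-- The Levi-Civita connection is compatible with the metric. -/
theorem mvfderiv_inner (hY : MDiffAt (T% Y) x) (hZ : MDiffAt (T% Z) x)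
    (u : TangentSpace 𝓘(ℝ, E) x) :
    mvfderiv 𝓘(ℝ, E) (fun y => (inner ℝ (Y y) (Z y) : ℝ)) x u
      = inner ℝ (leviCivita Y x u) (Z x) + inner ℝ (Y x) (leviCivita Z x u) := by
  have hU : MDiffAt (T% (extend E u)) x := mdifferentiableAt_extend ..
  have h1 := inner_leviCivita hU hY hZ
  have h2 := inner_leviCivita hU hZ hY
  simp only [extend_apply_self] at h1 h2
  rw [h1, real_inner_comm, h2]
  have c1 : (fun y => (inner ℝ (Z y) (Y y) : ℝ)) = fun y => inner ℝ (Y y) (Z y) := by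
    ext y; exact real_inner_comm _ _
  have c2 : (fun y => (inner ℝ (Y y) (extend E u y) : ℝ)) =
      fun y => inner ℝ (extend E u y) (Y y) := by
    ext y; exact real_inner_comm _ _
  have c3 : (fun y => (inner ℝ (extend E u y) (Z y) : ℝ)) =
      fun y => inner ℝ (Z y) (extend E u y) := by
    ext y; exact real_inner_comm _ _
  simp only [koszul, c1, c2, c3, extend_apply_self]
  rw [mlieBracket_swap_apply (V := extend E u) (W := Y), mlieBracket_swap_apply (V := Y) (W := Z),
    mlieBracket_swap_apply (V := Z) (W := extend E u)]
  simp only [inner_neg_left]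
  ring

/-- The Levi-Civita connection is torsion free. -/
theorem leviCivita_sub_leviCivita (hX : MDiffAt (T% X) x) (hY : MDiffAt (T% Y) x) :
    leviCivita Y x (X x) - leviCivita X x (Y x) = mlieBracket 𝓘(ℝ, E) X Y x := by
  refine ext_inner_right ℝ fun w => ?_
  have hW : MDiffAt (T% (extend E w)) x := mdifferentiableAt_extend ..
  have h1 := inner_leviCivita hX hY hW
  have h2 := inner_leviCivita hY hX hW
  simp only [extend_apply_self] at h1 h2
  rw [inner_sub_left, h1, h2]
  have c1 : (fun y => (inner ℝ (X y) (extend E w y) : ℝ)) =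
      fun y => inner ℝ (extend E w y) (X y) := by
    ext y; exact real_inner_comm _ _
  have c2 : (fun y => (inner ℝ (Y y) (extend E w y) : ℝ)) =
      fun y => inner ℝ (extend E w y) (Y y) := by
    ext y; exact real_inner_comm _ _
  have c3 : (fun y => (inner ℝ (Y y) (X y) : ℝ)) = fun y => inner ℝ (X y) (Y y) := by
    ext y; exact real_inner_comm _ _
  simp only [koszul, c1, c2, c3, extend_apply_self]
  rw [mlieBracket_swap_apply (V := Y) (W := X), mlieBracket_swap_apply (V := X) (W := extend E w),
    mlieBracket_swap_apply (V := extend E w) (W := Y)]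
  simp only [inner_neg_left]
  ring

theorem leviCivita_add (hY : MDiffAt (T% Y) x) (hZ : MDiffAt (T% Z) x)
    (u : TangentSpace 𝓘(ℝ, E) x) :
    leviCivita (fun y => Y y + Z y) x u = leviCivita Y x u + leviCivita Z x u := by
  refine ext_inner_right ℝ fun w => ?_
  have hW : MDiffAt (T% (extend E w)) x := mdifferentiableAt_extend ..
  have hYZ : MDiffAt (T% (fun y => Y y + Z y)) x := mdifferentiableAt_add_section hY hZ
  have h1 := mvfderiv_inner hYZ hW u
  have h2 := mvfderiv_inner hY hW u
  have h3 := mvfderiv_inner hZ hW u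
  have h4 := mvfderiv_fun_add (mdifferentiableAt_inner hY hW) (mdifferentiableAt_inner hZ hW)
  simp only [inner_add_left, h4, add_apply, h2, h3, extend_apply_self] at h1 ⊢
  linarith

/-- The Leibniz rule for the Levi-Civita connection. -/
theorem leviCivita_smul {f : M → ℝ} (hf : MDiffAt f x) (hY : MDiffAt (T% Y) x)
    (u : TangentSpace 𝓘(ℝ, E) x) :
    leviCivita (fun y => f y • Y y) x u
      = mvfderiv 𝓘(ℝ, E) f x u • Y x + f x • leviCivita Y x u := by
  refine ext_inner_right ℝ fun w => ?_
  have hW : MDiffAt (T% (extend E w)) x := mdifferentiableAt_extend ..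
  have hfY : MDiffAt (T% (fun y => f y • Y y)) x := hf.smul_section hY
  have h1 := mvfderiv_inner hfY hW u
  have h2 := mvfderiv_inner hY hW u
  have h4 := mvfderiv_fun_mul hf (mdifferentiableAt_inner hY hW)
  simp only [inner_add_left, real_inner_smul_left, h4, add_apply, smul_apply, h2,
    extend_apply_self, smul_eq_mul] at h1 ⊢
  linarith

/-- Koszul's functional of smooth vector fields is a smooth function. -/
theorem SmoothFieldAt.contMDiffAt_koszul (hX : SmoothFieldAt X x) (hY : SmoothFieldAt Y x)
    (hZ : SmoothFieldAt Z x) : CMDiffAt ∞ (koszul X Y Z) x := by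
  have h := ((((((SmoothFieldAt.mvfderiv_apply (hY.contMDiffAt_inner hZ) hX).add
    (SmoothFieldAt.mvfderiv_apply (hZ.contMDiffAt_inner hX) hY)).sub
    (SmoothFieldAt.mvfderiv_apply (hX.contMDiffAt_inner hY) hZ)).add
    ((hX.mlieBracket hY).contMDiffAt_inner hZ)).sub ((hY.mlieBracket hZ).contMDiffAt_inner hX)).add
    ((hZ.mlieBracket hX).contMDiffAt_inner hY))
  exact (contMDiffAt_const (c := (1 / 2 : ℝ))).mul h

end LeviCivitaTheory

/-! ### Orthonormal frames -/

section OrthonormalFrames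

open VectorField FiberBundle

variable {E : Type*} [NormedAddCommGroup E] [NormedSpace ℝ E] [FiniteDimensional ℝ E]
  {M : Type*} [TopologicalSpace M] [ChartedSpace E M] [IsManifold 𝓘(ℝ, E) ∞ M]
  [Bundle.RiemannianBundle (fun x : M => TangentSpace 𝓘(ℝ, E) x)]
  [IsContMDiffRiemannianBundle 𝓘(ℝ, E) ∞ E (fun x : M => TangentSpace 𝓘(ℝ, E) x)]
  {x : M}

/-- The projection of a vector to the span of a finite orthonormal family. -/
theorem Orthonormal.starProjection_eq_sum {V ι : Type*} [NormedAddCommGroup V]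
    [InnerProductSpace ℝ V] [Fintype ι] {v : ι → V} (hv : Orthonormal ℝ v) {K : Submodule ℝ V}
    [K.HasOrthogonalProjection] (hK : Submodule.span ℝ (Set.range v) = K) (w : V) :
    K.starProjection w = ∑ i, (inner ℝ (v i) w : ℝ) • v i := by
  classical
  refine Submodule.eq_starProjection_of_mem_of_inner_eq_zero ?_ fun z hz => ?_
  · rw [← hK]
    exact Submodule.sum_mem _ fun i _ => Submodule.smul_mem _ _ (Submodule.subset_span ⟨i, rfl⟩)
  · rw [← hK] at hz
    induction hz using Submodule.span_induction with
    | mem z hz =>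
      obtain ⟨j, rfl⟩ := hz
      rw [real_inner_comm, inner_sub_right, inner_sum, sub_eq_zero]
      simp [real_inner_smul_right, orthonormal_iff_ite.1 hv]
    | zero => simp
    | add a b _ _ ha hb => rw [inner_add_right, ha, hb, add_zero]
    | smul a b _ hb => rw [inner_smul_right, hb, mul_zero]

/-- A family of vector fields that are smooth at `x` and form, at each point near `x`, an
orthonormal basis of the subspace `D` of the tangent space. -/
structure IsOrthonormalFrameAt {ι : Type*} (D : Π x : M, Submodule ℝ (TangentSpace 𝓘(ℝ, E) x))
    (e : ι → Π x : M, TangentSpace 𝓘(ℝ, E) x) (x : M) : Prop where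
  smooth : ∀ i, SmoothFieldAt (e i) x
  orthonormal : ∀ᶠ y in 𝓝 x, Orthonormal ℝ (fun i => e i y)
  span_eq : ∀ᶠ y in 𝓝 x, Submodule.span ℝ (Set.range fun i => e i y) = D y

/-- The Gram-Schmidt process applied pointwise to smooth fields yields smooth fields. -/
theorem SmoothFieldAt.gramSchmidt {m : ℕ} {s : Fin m → Π x : M, TangentSpace 𝓘(ℝ, E) x}
    (hs : ∀ i, SmoothFieldAt (s i) x) (hli : LinearIndependent ℝ (fun i => s i x)) (i : Fin m) :
    SmoothFieldAt (fun y => InnerProductSpace.gramSchmidt ℝ (fun i => s i y) i) x := by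
  induction i using WellFoundedLT.induction with
  | _ i ih =>
    have h : (fun y => InnerProductSpace.gramSchmidt ℝ (fun i => s i y) i) = fun y =>
        s i y - ∑ j ∈ Finset.Iio i,
          ((inner ℝ (InnerProductSpace.gramSchmidt ℝ (fun i => s i y) j) (s i y) : ℝ)
            / (inner ℝ (InnerProductSpace.gramSchmidt ℝ (fun i => s i y) j)
                (InnerProductSpace.gramSchmidt ℝ (fun i => s i y) j) : ℝ))
            • InnerProductSpace.gramSchmidt ℝ (fun i => s i y) j := by
      funext y
      rw [InnerProductSpace.gramSchmidt_def]
      simp only [Submodule.starProjection_singleton, real_inner_self_eq_norm_sq]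
      rfl
    rw [h]
    refine (hs i).sub (SmoothFieldAt.sum fun j hj =>
      SmoothFieldAt.smul ?_ (ih j (Finset.mem_Iio.1 hj)))
    have hj' := ih j (Finset.mem_Iio.1 hj)
    refine ContMDiffAt.div₀ (hj'.contMDiffAt_inner (hs i)) (hj'.contMDiffAt_inner hj') ?_
    rw [real_inner_self_eq_norm_sq]
    exact pow_ne_zero _ (norm_ne_zero_iff.2 (InnerProductSpace.gramSchmidt_ne_zero j hli))

theorem SmoothFieldAt.normalize {X : Π x : M, TangentSpace 𝓘(ℝ, E) x} (hX : SmoothFieldAt X x)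
    (h0 : X x ≠ 0) : SmoothFieldAt (fun y => ‖X y‖⁻¹ • X y) x := by
  refine SmoothFieldAt.smul ?_ hX
  have h1 : (fun y => ‖X y‖⁻¹) = fun y => (Real.sqrt (inner ℝ (X y) (X y)))⁻¹ := by
    funext y; rw [← norm_eq_sqrt_real_inner]
  have h2 : (inner ℝ (X x) (X x) : ℝ) ≠ 0 := inner_self_ne_zero.2 h0
  rw [h1]
  refine ContMDiffAt.inv₀ ?_ ?_
  · exact (Real.contDiffAt_sqrt h2).contMDiffAt.comp x (hX.contMDiffAt_inner hX)
  · rw [← norm_eq_sqrt_real_inner]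
    exact norm_ne_zero_iff.2 h0

/-- The Gram-Schmidt process turns a local frame of a distribution into an orthonormal one. -/
theorem exists_isOrthonormalFrameAt {m : ℕ} {D : Π x : M, Submodule ℝ (TangentSpace 𝓘(ℝ, E) x)}
    {s : Fin m → Π x : M, TangentSpace 𝓘(ℝ, E) x} (hs : ∀ i, SmoothFieldAt (s i) x)
    (hli : ∀ᶠ y in 𝓝 x, LinearIndependent ℝ (fun i => s i y))
    (hspan : ∀ᶠ y in 𝓝 x, Submodule.span ℝ (Set.range fun i => s i y) = D y) :
    ∃ e : Fin m → Π x : M, TangentSpace 𝓘(ℝ, E) x, IsOrthonormalFrameAt D e x := by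
  refine ⟨fun i y => InnerProductSpace.gramSchmidtNormed ℝ (fun i => s i y) i, fun i => ?_, ?_, ?_⟩
  · have := (SmoothFieldAt.gramSchmidt hs hli.self_of_nhds i).normalize
      (InnerProductSpace.gramSchmidt_ne_zero i hli.self_of_nhds)
    exact this
  · filter_upwards [hli] with y hy
    exact InnerProductSpace.gramSchmidtNormed_orthonormal hy
  · filter_upwards [hspan] with y hy
    rw [← hy]
    exact (InnerProductSpace.span_gramSchmidtNormed_range _).trans
      (InnerProductSpace.span_gramSchmidt ℝ _)

variable (x) in
/-- Every point has a local orthonormal frame of the tangent bundle. -/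
theorem exists_isOrthonormalFrameAt_top :
    ∃ (m : ℕ) (e : Fin m → Π x : M, TangentSpace 𝓘(ℝ, E) x),
      IsOrthonormalFrameAt (fun _ => ⊤) e x := by
  let t := trivializationAt E (TangentSpace 𝓘(ℝ, E) : M → Type _) x
  have hx : x ∈ t.baseSet := FiberBundle.mem_baseSet_trivializationAt' x
  let b := Module.finBasis ℝ E
  have hf := t.isLocalFrameOn_localFrame_baseSet 𝓘(ℝ, E) ∞ b
  refine ⟨_, exists_isOrthonormalFrameAt (s := t.localFrame b)
    (fun i => contMDiffAt_localFrame_of_mem _ t b i hx) ?_ ?_⟩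
  · filter_upwards [t.open_baseSet.mem_nhds hx] with y hy using hf.linearIndependent hy
  · filter_upwards [t.open_baseSet.mem_nhds hx] with y hy using eq_top_iff.2 (hf.generating hy)

/-- The Levi-Civita derivative of a smooth vector field along a smooth vector field is smooth. -/
theorem SmoothFieldAt.covariantDerivative {X Y : Π x : M, TangentSpace 𝓘(ℝ, E) x}
    (hX : SmoothFieldAt X x) (hY : SmoothFieldAt Y x) :
    SmoothFieldAt (fun y => leviCivita Y y (X y)) x := by
  obtain ⟨m, e, he⟩ := exists_isOrthonormalFrameAt_top (E := E) x
  refine SmoothFieldAt.congr (SmoothFieldAt.sum (s := Finset.univ)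
    (X := fun i y => koszul X Y (e i) y • e i y)
    fun i _ => SmoothFieldAt.smul (hX.contMDiffAt_koszul hY (he.smooth i)) (he.smooth i)) ?_
  have h1 : ∀ᶠ y in 𝓝 x, ∀ i, MDiffAt (T% (e i)) y :=
    Filter.eventually_all.2 fun i => (he.smooth i).eventually_mdifferentiableAt
  filter_upwards [h1, hX.eventually_mdifferentiableAt, hY.eventually_mdifferentiableAt,
    he.orthonormal, he.span_eq] with y h1 h2 h3 h4 h5
  have h6 := h4.starProjection_eq_sum h5 (leviCivita Y y (X y))
  rw [Submodule.starProjection_top, ContinuousLinearMap.id_apply] at h6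
  refine h6.trans (Finset.sum_congr rfl fun i _ => ?_)
  rw [← inner_leviCivita h2 h3 (h1 i), real_inner_comm]

namespace IsOrthonormalFrameAt

variable {ι : Type*} [Fintype ι] {D : Π x : M, Submodule ℝ (TangentSpace 𝓘(ℝ, E) x)}
  {e : ι → Π x : M, TangentSpace 𝓘(ℝ, E) x}

theorem mem (he : IsOrthonormalFrameAt D e x) (i : ι) : ∀ᶠ y in 𝓝 x, e i y ∈ D y := by
  filter_upwards [he.span_eq] with y hy
  rw [← hy]
  exact Submodule.subset_span ⟨i, rfl⟩

/-- Orthogonal projection to a distribution with a local orthonormal frame preserves smoothness. -/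
theorem smooth_starProjection (he : IsOrthonormalFrameAt D e x)
    {Y : Π x : M, TangentSpace 𝓘(ℝ, E) x} (hY : SmoothFieldAt Y x) :
    SmoothFieldAt (fun y => (D y).starProjection (Y y)) x := by
  refine SmoothFieldAt.congr (SmoothFieldAt.sum (s := Finset.univ)
    (X := fun i y => (inner ℝ (e i y) (Y y) : ℝ) • e i y)
    fun i _ => SmoothFieldAt.smul ((he.smooth i).contMDiffAt_inner hY) (he.smooth i)) ?_
  filter_upwards [he.orthonormal, he.span_eq] with y h4 h5
  exact h4.starProjection_eq_sum h5 (Y y)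

end IsOrthonormalFrameAt

end OrthonormalFrames

/-! ### Foliation charts and involutivity -/

section FoliationCharts

open VectorField FiberBundle

variable {E : Type*} [NormedAddCommGroup E] [NormedSpace ℝ E] [FiniteDimensional ℝ E]
  {M : Type*} [TopologicalSpace M] [ChartedSpace E M] [IsManifold 𝓘(ℝ, E) ∞ M] {k q : ℕ} {x : M}

variable {P : Type*} [NormedAddCommGroup P] [NormedSpace ℝ P]

theorem mpullback_eq_mfderiv_symm {φ : OpenPartialHomeomorph M P}
    (hφ : φ.MDifferentiable 𝓘(ℝ, E) 𝓘(ℝ, P)) {y : M} (hy : y ∈ φ.source)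
    (W : Π z : P, TangentSpace 𝓘(ℝ, P) z) :
    mpullback 𝓘(ℝ, E) 𝓘(ℝ, P) φ W y = (hφ.mfderiv hy).symm (W (φ y)) := by
  rw [mpullback_apply, show mfderiv 𝓘(ℝ, E) 𝓘(ℝ, P) φ y = (hφ.mfderiv hy : _ →L[ℝ] _) from rfl,
    ContinuousLinearMap.inverse_equiv]
  rfl

theorem mpullback_symm_eq_mfderiv {φ : OpenPartialHomeomorph M P}
    (hφ : φ.MDifferentiable 𝓘(ℝ, E) 𝓘(ℝ, P)) {z : P} (hz : z ∈ φ.target)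
    (W : Π y : M, TangentSpace 𝓘(ℝ, E) y) :
    mpullback 𝓘(ℝ, P) 𝓘(ℝ, E) φ.symm W z
      = (mfderiv 𝓘(ℝ, E) 𝓘(ℝ, P) φ (φ.symm z) (W (φ.symm z)) : P) := by
  rw [mpullback_apply,
    show mfderiv 𝓘(ℝ, P) 𝓘(ℝ, E) φ.symm z = (hφ.symm.mfderiv hz : _ →L[ℝ] _) from rfl,
    ContinuousLinearMap.inverse_equiv]
  rfl

theorem mlieBracket_eq_fderiv_sub (V W : Π z : P, TangentSpace 𝓘(ℝ, P) z) (z : P) :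
    mlieBracket 𝓘(ℝ, P) V W z
      = (fderiv ℝ (W : P → P) z (V z) - fderiv ℝ (V : P → P) z (W z) : P) := by
  rw [← mlieBracketWithin_univ, mlieBracketWithin_eq_lieBracketWithin]
  exact congrFun (lieBracketWithin_univ (𝕜 := ℝ) (V := V) (W := W)) z

/-- A constant vector field on a normed space. -/
def constField (w : P) : Π z : P, TangentSpace 𝓘(ℝ, P) z := fun _ => w

namespace Foliation

/-- The Lie bracket of two vector fields tangent to a foliation is tangent to it. -/
theorem mlieBracket_mem_tangent (F : Foliation E M k q) {X Y : Π x : M, TangentSpace 𝓘(ℝ, E) x}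
    (hX : SmoothFieldAt X x) (hY : SmoothFieldAt Y x) (hXF : ∀ᶠ y in 𝓝 x, X y ∈ F.tangent y)
    (hYF : ∀ᶠ y in 𝓝 x, Y y ∈ F.tangent y) : mlieBracket 𝓘(ℝ, E) X Y x ∈ F.tangent x := by
  obtain ⟨φ, hx, h1, h2, h3⟩ := F.exists_chart x
  have hφ : φ.MDifferentiable 𝓘(ℝ, E)
      𝓘(ℝ, EuclideanSpace ℝ (Fin k) × EuclideanSpace ℝ (Fin q)) :=
    ⟨h1.mdifferentiableOn (by simp), h2.mdifferentiableOn (by simp)⟩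
  have hz : φ x ∈ φ.target := φ.map_source hx
  have hzx : φ.symm (φ x) = x := φ.left_inv hx
  set P := EuclideanSpace ℝ (Fin k) × EuclideanSpace ℝ (Fin q)
  -- In the chart both fields have vanishing second component, hence so has their bracket.
  have hsnd : ∀ W : Π y : M, TangentSpace 𝓘(ℝ, E) y, (∀ᶠ y in 𝓝 x, W y ∈ F.tangent y) →
      ∀ᶠ z in 𝓝 (φ x), (mpullback 𝓘(ℝ, P) 𝓘(ℝ, E) φ.symm W z : P).2 = 0 := by
    intro W hW
    have h4 : Filter.Tendsto φ.symm (𝓝 (φ x)) (𝓝 x) := by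
      have := φ.continuousAt_symm hz
      rwa [ContinuousAt, hzx] at this
    filter_upwards [h4.eventually hW, φ.open_target.mem_nhds hz] with z hz1 hz2
    rw [mpullback_symm_eq_mfderiv hφ hz2]
    exact (h3 _ (φ.map_target hz2) _).1 hz1
  have hder : ∀ V : P → P, (∀ᶠ z in 𝓝 (φ x), (V z).2 = 0) → ∀ w : P,
      (fderiv ℝ V (φ x) w).2 = 0 := by
    intro V hV w
    by_cases hd : DifferentiableAt ℝ V (φ x)
    · have h5 : fderiv ℝ (fun z => (V z).2) (φ x) = 0 := by
        rw [Filter.EventuallyEq.fderiv_eq (f := fun _ => (0 : EuclideanSpace ℝ (Fin q))) hV]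
        simp
      have h6 : HasFDerivAt (fun z => (V z).2) _ (φ x) :=
        (ContinuousLinearMap.snd ℝ (EuclideanSpace ℝ (Fin k))
          (EuclideanSpace ℝ (Fin q))).hasFDerivAt.comp (φ x) hd.hasFDerivAt
      have h7 := h6.fderiv.symm.trans h5
      exact DFunLike.congr_fun h7 w
    · rw [fderiv_zero_of_not_differentiableAt hd]; rfl
  have : IsManifold 𝓘(ℝ, E) (minSmoothness ℝ 2) M := by
    rw [minSmoothness_of_isRCLikeNormedField]; infer_instance
  have hbr := mpullback_mlieBracket (n := ∞) (f := φ.symm) (V := X) (W := Y)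
    (I := 𝓘(ℝ, P)) (I' := 𝓘(ℝ, E)) (x₀ := φ x) (hzx.symm ▸ hX.mdifferentiableAt)
    (hzx.symm ▸ hY.mdifferentiableAt) ((h2 _ hz).contMDiffAt (φ.open_target.mem_nhds hz))
    (by rw [minSmoothness_of_isRCLikeNormedField]; exact ENat.LEInfty.out)
  rw [mpullback_symm_eq_mfderiv hφ hz] at hbr
  rw [← hzx]
  refine (h3 _ (φ.map_target hz) _).2 ?_
  refine (congrArg Prod.snd (hbr.trans (mlieBracket_eq_fderiv_sub _ _ _))).trans ?_
  exact (congrArg₂ (· - ·) (hder _ (hsnd Y hYF) _) (hder _ (hsnd X hXF) _)).trans (sub_zero 0)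

variable [Bundle.RiemannianBundle (fun x : M => TangentSpace 𝓘(ℝ, E) x)]
  [IsContMDiffRiemannianBundle 𝓘(ℝ, E) ∞ E (fun x : M => TangentSpace 𝓘(ℝ, E) x)]

/-- The preimages of a basis of the first factor under an isomorphism onto a product form a basis of
the kernel of its second component. -/
theorem span_symm_inl_eq {V ι P Q : Type*} [AddCommGroup V] [Module ℝ V] [Fintype ι]
    [AddCommGroup P] [Module ℝ P] [AddCommGroup Q] [Module ℝ Q] (L : V ≃ₗ[ℝ] P × Q)
    (b : Module.Basis ι ℝ P) :
    LinearIndependent ℝ (fun i => L.symm (b i, 0)) ∧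
      ∀ v, v ∈ Submodule.span ℝ (Set.range fun i => L.symm (b i, 0)) ↔ (L v).2 = 0 := by
  have hinl : LinearIndependent ℝ (fun i => ((b i, 0) : P × Q)) :=
    b.linearIndependent.map' (LinearMap.inl ℝ P Q) (LinearMap.ker_eq_bot.2 LinearMap.inl_injective)
  refine ⟨hinl.map' L.symm.toLinearMap (LinearMap.ker_eq_bot.2 L.symm.injective), fun v => ⟨?_, ?_⟩⟩
  · intro hv
    induction hv using Submodule.span_induction with
    | mem v hv => obtain ⟨i, rfl⟩ := hv; simp
    | zero => simp
    | add a b _ _ ha hb => simp [ha, hb]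
    | smul a b _ hb => simp [hb]
  · intro hv
    have h : v = ∑ i, b.repr (L v).1 i • L.symm (b i, 0) := by
      apply L.injective
      simp only [map_sum, map_smul, LinearEquiv.apply_symm_apply]
      refine Prod.ext ?_ ?_
      · simp [Prod.fst_sum, b.sum_repr]
      · simp [Prod.snd_sum, hv]
    rw [h]
    exact Submodule.sum_mem _ fun i _ => Submodule.smul_mem _ _ (Submodule.subset_span ⟨i, rfl⟩)

variable (x) in
/-- Coordinate fields along the leaves in a foliation chart, orthonormalized, form a local
orthonormal frame of the tangent distribution. -/
theorem exists_orthonormalFrame (F : Foliation E M k q) :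
    ∃ e : Fin k → Π x : M, TangentSpace 𝓘(ℝ, E) x, IsOrthonormalFrameAt F.tangent e x := by
  obtain ⟨φ, hx, h1, h2, h3⟩ := F.exists_chart x
  have hφ : φ.MDifferentiable 𝓘(ℝ, E)
      𝓘(ℝ, EuclideanSpace ℝ (Fin k) × EuclideanSpace ℝ (Fin q)) :=
    ⟨h1.mdifferentiableOn (by simp), h2.mdifferentiableOn (by simp)⟩
  let b := (EuclideanSpace.basisFun (Fin k) ℝ).toBasis
  let s : Fin k → Π x : M, TangentSpace 𝓘(ℝ, E) x := fun i =>
    mpullback 𝓘(ℝ, E) 𝓘(ℝ, EuclideanSpace ℝ (Fin k) × EuclideanSpace ℝ (Fin q)) φ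
      (constField (b i, 0))
  have hs : ∀ y (hy : y ∈ φ.source) i, s i y = (hφ.mfderiv hy).symm (constField (b i, 0) (φ y)) :=
    fun y hy i => mpullback_eq_mfderiv_symm hφ hy _
  have hsrc : ∀ᶠ y in 𝓝 x, y ∈ φ.source := φ.open_source.mem_nhds hx
  have hlin := fun y (hy : y ∈ φ.source) =>
    span_symm_inl_eq (V := TangentSpace 𝓘(ℝ, E) y) (P := EuclideanSpace ℝ (Fin k))
      (Q := EuclideanSpace ℝ (Fin q)) (hφ.mfderiv hy).toLinearEquiv b
  refine exists_isOrthonormalFrameAt (s := s) (fun i => ?_) ?_ ?_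
  · refine ContMDiffAt.mpullback_vectorField_preimage (n := ∞) ?_
      ((h1 x hx).contMDiffAt (φ.open_source.mem_nhds hx)) ⟨hφ.mfderiv hx, rfl⟩ (by simp)
    exact contMDiffAt_vectorSpace_iff_contDiffAt.2 contDiffAt_const
  · filter_upwards [hsrc] with y hy
    rw [funext (hs y hy)]
    exact (hlin y hy).1
  · filter_upwards [hsrc] with y hy
    rw [funext (hs y hy)]
    ext v
    exact ((hlin y hy).2 v).trans (h3 y hy v).symm

end Foliation

end FoliationCharts

/-! ### Traces and the second fundamental form -/

section TraceIndependence

variable {K W ι ι' : Type*} [NormedAddCommGroup K] [InnerProductSpace ℝ K] [AddCommGroup W]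
  [Module ℝ W] [Fintype ι] [Fintype ι']

/-- The trace of a bilinear map with respect to an orthonormal basis does not depend on the
basis. -/
theorem OrthonormalBasis.sum_bilin_eq (B : K →ₗ[ℝ] K →ₗ[ℝ] W) (b : OrthonormalBasis ι ℝ K)
    (e : OrthonormalBasis ι' ℝ K) : ∑ i, B (b i) (b i) = ∑ j, B (e j) (e j) := by
  classical
  have h : ∀ i, B (b i) (b i) = ∑ j, ∑ l, ((inner ℝ (e j) (b i) : ℝ) * inner ℝ (b i) (e l)) •
      B (e j) (e l) := by
    intro i
    conv_lhs => rw [← e.sum_repr' (b i)]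
    simp only [map_sum, LinearMap.sum_apply, map_smul, LinearMap.smul_apply, Finset.smul_sum,
      smul_smul]
    rw [Finset.sum_comm]
    refine Finset.sum_congr rfl fun j _ => Finset.sum_congr rfl fun l _ => ?_
    rw [real_inner_comm (e l) (b i), mul_comm]
  simp only [h]
  rw [Finset.sum_comm]
  refine Finset.sum_congr rfl fun j _ => ?_
  rw [Finset.sum_comm]
  simp only [← Finset.sum_smul, b.sum_inner_mul_inner, orthonormal_iff_ite.1 e.orthonormal]
  simp

/-- An orthonormal family spanning a subspace, as an orthonormal basis of that subspace. -/
theorem Orthonormal.exists_orthonormalBasis {V : Type*} [NormedAddCommGroup V]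
    [InnerProductSpace ℝ V] {v : ι → V} (hv : Orthonormal ℝ v) {D : Submodule ℝ V}
    (hD : Submodule.span ℝ (Set.range v) = D) :
    ∃ b : OrthonormalBasis ι ℝ D, ∀ i, (b i : V) = v i := by
  have hm : ∀ i, v i ∈ D := fun i => hD ▸ Submodule.subset_span ⟨i, rfl⟩
  let w : ι → D := fun i => ⟨v i, hm i⟩
  have hw : Orthonormal ℝ w := by
    refine ⟨fun i => hv.1 i, fun i j hij => hv.2 hij⟩
  have hspan : ⊤ ≤ Submodule.span ℝ (Set.range w) := by
    rintro ⟨z, hz⟩ -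
    have h : Submodule.map D.subtype (Submodule.span ℝ (Set.range w)) = D := by
      rw [Submodule.map_span, ← Set.range_comp]
      exact hD
    rw [← h] at hz
    obtain ⟨z', hz', rfl⟩ := hz
    exact hz'
  exact ⟨OrthonormalBasis.mk hw hspan, fun i => by rw [OrthonormalBasis.coe_mk]⟩

end TraceIndependence

namespace Foliation

open VectorField FiberBundle

variable {E : Type*} [NormedAddCommGroup E] [NormedSpace ℝ E] [FiniteDimensional ℝ E]
  {M : Type*} [TopologicalSpace M] [ChartedSpace E M] [IsManifold 𝓘(ℝ, E) ∞ M]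
  [Bundle.RiemannianBundle (fun x : M => TangentSpace 𝓘(ℝ, E) x)]
  [IsContMDiffRiemannianBundle 𝓘(ℝ, E) ∞ E (fun x : M => TangentSpace 𝓘(ℝ, E) x)]
  {k q : ℕ} (F : Foliation E M k q) {x : M} {X Y V : Π x : M, TangentSpace 𝓘(ℝ, E) x}

theorem smooth_starProjection (hY : SmoothFieldAt Y x) :
    SmoothFieldAt (fun y => (F.tangent y).starProjection (Y y)) x := by
  obtain ⟨e, he⟩ := F.exists_orthonormalFrame x
  exact he.smooth_starProjection hY

theorem smooth_starProjection_orthogonal (hY : SmoothFieldAt Y x) :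
    SmoothFieldAt (fun y => (F.tangent y)ᗮ.starProjection (Y y)) x := by
  refine (hY.sub (F.smooth_starProjection hY)).congr (Filter.Eventually.of_forall fun y => ?_)
  rw [Submodule.starProjection_orthogonal_val]

/-- Vectors tangent to a foliation extend to smooth fields tangent to it. -/
theorem exists_smooth_extension {v : TangentSpace 𝓘(ℝ, E) x} (hv : v ∈ F.tangent x) :
    ∃ V : Π x : M, TangentSpace 𝓘(ℝ, E) x, SmoothFieldAt V x ∧ (∀ y, V y ∈ F.tangent y) ∧
      V x = v := by
  refine ⟨fun y => (F.tangent y).starProjection (extend E v y),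
    F.smooth_starProjection (smoothFieldAt_extend v),
    fun y => Submodule.starProjection_apply_mem _ _, ?_⟩
  simp only [extend_apply_self]
  exact Submodule.starProjection_eq_self_iff.2 hv

theorem exists_smooth_normal_extension {w : TangentSpace 𝓘(ℝ, E) x} (hw : w ∈ (F.tangent x)ᗮ) :
    ∃ N : Π x : M, TangentSpace 𝓘(ℝ, E) x, SmoothFieldAt N x ∧ (∀ y, N y ∈ (F.tangent y)ᗮ) ∧
      N x = w := by
  refine ⟨fun y => (F.tangent y)ᗮ.starProjection (extend E w y),
    F.smooth_starProjection_orthogonal (smoothFieldAt_extend w),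
    fun y => Submodule.starProjection_apply_mem _ _, ?_⟩
  simp only [extend_apply_self]
  exact Submodule.starProjection_eq_self_iff.2 hw

end Foliation

/-- If the inner product of two fields is constant near a point, then the derivative can be moved
from one field to the other at the cost of a sign. -/
theorem inner_leviCivita_eq_neg {E : Type*} [NormedAddCommGroup E] [NormedSpace ℝ E]
    [FiniteDimensional ℝ E] {M : Type*} [TopologicalSpace M] [ChartedSpace E M]
    [IsManifold 𝓘(ℝ, E) ∞ M] [Bundle.RiemannianBundle (fun x : M => TangentSpace 𝓘(ℝ, E) x)]
    [IsContMDiffRiemannianBundle 𝓘(ℝ, E) ∞ E (fun x : M => TangentSpace 𝓘(ℝ, E) x)]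
    {Y Z : Π x : M, TangentSpace 𝓘(ℝ, E) x} {x : M} {a : ℝ}
    (hY : MDiffAt (T% Y) x) (hZ : MDiffAt (T% Z) x)
    (h : ∀ᶠ y in 𝓝 x, inner ℝ (Y y) (Z y) = a) (u : TangentSpace 𝓘(ℝ, E) x) :
    (inner ℝ (leviCivita Y x u) (Z x) : ℝ) = -inner ℝ (Y x) (leviCivita Z x u) := by
  have h1 := mvfderiv_inner hY hZ u
  have h2 : mvfderiv 𝓘(ℝ, E) (fun y => (inner ℝ (Y y) (Z y) : ℝ)) x u = 0 := by
    have e : (fun y => (inner ℝ (Y y) (Z y) : ℝ)) =ᶠ[𝓝 x] fun _ => a := h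
    rw [e.mvfderiv_eq, mvfderiv_const]
    rfl
  rw [h2] at h1
  linarith

namespace Foliation

open VectorField FiberBundle

variable {E : Type*} [NormedAddCommGroup E] [NormedSpace ℝ E] [FiniteDimensional ℝ E]
  {M : Type*} [TopologicalSpace M] [ChartedSpace E M] [IsManifold 𝓘(ℝ, E) ∞ M]
  [Bundle.RiemannianBundle (fun x : M => TangentSpace 𝓘(ℝ, E) x)]
  [IsContMDiffRiemannianBundle 𝓘(ℝ, E) ∞ E (fun x : M => TangentSpace 𝓘(ℝ, E) x)]
  {k q : ℕ} (F : Foliation E M k q) {x : M} {X Y V : Π x : M, TangentSpace 𝓘(ℝ, E) x}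

/-- The components of the second fundamental form are those of `∇_u V` for any tangent field `V`
extending the second argument. Against a normal field `N` both sides are `-⟨V, ∇_u N⟩`, which
depends only on the value of `V` at the point. -/
theorem inner_secondFundamentalForm (hV : MDiffAt (T% V) x) (hVF : ∀ᶠ y in 𝓝 x, V y ∈ F.tangent y)
    (u : TangentSpace 𝓘(ℝ, E) x) {w : TangentSpace 𝓘(ℝ, E) x} (hw : w ∈ (F.tangent x)ᗮ) :
    (inner ℝ (F.secondFundamentalForm x u (V x)) w : ℝ) = inner ℝ (leviCivita V x u) w := by
  obtain ⟨N, hN, hNF, rfl⟩ := F.exists_smooth_normal_extension hw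
  have hV' : SmoothFieldAt (fun y => (F.tangent y).starProjection (extend E (V x) y)) x :=
    F.smooth_starProjection (smoothFieldAt_extend _)
  rw [secondFundamentalForm, Submodule.inner_starProjection_left_eq_right,
    Submodule.starProjection_eq_self_iff.2 hw]
  rw [inner_leviCivita_eq_neg (a := 0) hV hN.mdifferentiableAt
      (hVF.mono fun y hy => (hNF y) _ hy),
    inner_leviCivita_eq_neg (a := 0) hV'.mdifferentiableAt hN.mdifferentiableAt
      (Filter.Eventually.of_forall fun y => (hNF y) _ (Submodule.starProjection_apply_mem _ _))]
  simp only [extend_apply_self]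
  rw [Submodule.starProjection_eq_self_iff.2 hVF.self_of_nhds]

theorem secondFundamentalForm_mem (u v : TangentSpace 𝓘(ℝ, E) x) :
    F.secondFundamentalForm x u v ∈ (F.tangent x)ᗮ :=
  Submodule.starProjection_apply_mem _ _

/-- The second fundamental form does not depend on the tangent field extending its second
argument: the projected extension in its definition may be replaced by any other one. -/
theorem secondFundamentalForm_eq (hV : MDiffAt (T% V) x) (hVF : ∀ᶠ y in 𝓝 x, V y ∈ F.tangent y)
    (u : TangentSpace 𝓘(ℝ, E) x) :
    F.secondFundamentalForm x u (V x) = (F.tangent x)ᗮ.starProjection (leviCivita V x u) := by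
  refine (Submodule.eq_starProjection_of_mem_of_inner_eq_zero (F.secondFundamentalForm_mem _ _)
    fun w hw => ?_).symm
  rw [inner_sub_left, F.inner_secondFundamentalForm hV hVF u hw, sub_self]

/-- The second fundamental form as a bilinear map on the tangent space of the leaf. -/
noncomputable def sffBilin (x : M) :
    F.tangent x →ₗ[ℝ] F.tangent x →ₗ[ℝ] TangentSpace 𝓘(ℝ, E) x :=
  LinearMap.mk₂ ℝ (fun u v => F.secondFundamentalForm x u v)
    (fun u u' v => by
      obtain ⟨V, hV, hVF, hv⟩ := F.exists_smooth_extension v.2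
      simp only [← hv, F.secondFundamentalForm_eq hV.mdifferentiableAt (.of_forall hVF),
        Submodule.coe_add, leviCivita_add_right hV.mdifferentiableAt, map_add])
    (fun a u v => by
      obtain ⟨V, hV, hVF, hv⟩ := F.exists_smooth_extension v.2
      simp only [← hv, F.secondFundamentalForm_eq hV.mdifferentiableAt (.of_forall hVF),
        Submodule.coe_smul, leviCivita_smul_right hV.mdifferentiableAt, map_smul])
    (fun u v v' => by
      obtain ⟨V, hV, hVF, hv⟩ := F.exists_smooth_extension v.2
      obtain ⟨V', hV', hVF', hv'⟩ := F.exists_smooth_extension v'.2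
      have h := F.secondFundamentalForm_eq (hV.add hV').mdifferentiableAt
        (.of_forall fun y => Submodule.add_mem _ (hVF y) (hVF' y)) (u : TangentSpace 𝓘(ℝ, E) x)
      rw [Submodule.coe_add, ← hv, ← hv', h,
        leviCivita_add hV.mdifferentiableAt hV'.mdifferentiableAt, map_add,
        F.secondFundamentalForm_eq hV.mdifferentiableAt (.of_forall hVF),
        F.secondFundamentalForm_eq hV'.mdifferentiableAt (.of_forall hVF')])
    (fun a u v => by
      obtain ⟨V, hV, hVF, hv⟩ := F.exists_smooth_extension v.2
      have h := F.secondFundamentalForm_eq (hV.const_smul a).mdifferentiableAt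
        (.of_forall fun y => Submodule.smul_mem _ _ (hVF y)) (u : TangentSpace 𝓘(ℝ, E) x)
      have h2 := leviCivita_smul (f := fun _ => a) mdifferentiableAt_const hV.mdifferentiableAt
        (u : TangentSpace 𝓘(ℝ, E) x)
      rw [Submodule.coe_smul, ← hv, h, h2, mvfderiv_const,
        F.secondFundamentalForm_eq hV.mdifferentiableAt (.of_forall hVF)]
      simp)

theorem sffBilin_apply (u v : F.tangent x) :
    F.sffBilin x u v = F.secondFundamentalForm x u v := rfl

/-- The second fundamental form of the leaves of a foliation is symmetric, because the tangent
distribution is involutive. -/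
theorem secondFundamentalForm_comm {u v : TangentSpace 𝓘(ℝ, E) x} (hu : u ∈ F.tangent x)
    (hv : v ∈ F.tangent x) :
    F.secondFundamentalForm x u v = F.secondFundamentalForm x v u := by
  obtain ⟨U, hU, hUF, rfl⟩ := F.exists_smooth_extension hu
  obtain ⟨V, hV, hVF, rfl⟩ := F.exists_smooth_extension hv
  rw [F.secondFundamentalForm_eq hU.mdifferentiableAt (.of_forall hUF),
    F.secondFundamentalForm_eq hV.mdifferentiableAt (.of_forall hVF),
    ← sub_eq_zero, ← map_sub,
    leviCivita_sub_leviCivita hU.mdifferentiableAt hV.mdifferentiableAt,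
    Submodule.starProjection_orthogonal_val, sub_eq_zero, eq_comm,
    Submodule.starProjection_eq_self_iff]
  exact F.mlieBracket_mem_tangent hU hV (.of_forall hUF) (.of_forall hVF)

variable {ι : Type*} [Fintype ι]

theorem meanCurvature_eq_sum {e : ι → TangentSpace 𝓘(ℝ, E) x} (he : Orthonormal ℝ e)
    (hspan : Submodule.span ℝ (Set.range e) = F.tangent x) :
    F.meanCurvature x = (k : ℝ)⁻¹ • ∑ i, F.secondFundamentalForm x (e i) (e i) := by
  obtain ⟨b, hb⟩ := he.exists_orthonormalBasis hspan
  have h := OrthonormalBasis.sum_bilin_eq (F.sffBilin x) (stdOrthonormalBasis ℝ (F.tangent x)) b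
  simp only [sffBilin_apply, hb] at h
  rw [meanCurvature, h]

theorem divergence_eq_sum {e : ι → TangentSpace 𝓘(ℝ, E) x} (he : Orthonormal ℝ e)
    (hspan : Submodule.span ℝ (Set.range e) = F.tangent x) (hX : MDiffAt (T% X) x) :
    F.divergence X x = ∑ i, inner ℝ (e i) (leviCivita X x (e i)) := by
  obtain ⟨b, hb⟩ := he.exists_orthonormalBasis hspan
  let B : F.tangent x →ₗ[ℝ] F.tangent x →ₗ[ℝ] ℝ :=
    LinearMap.mk₂ ℝ (fun u v => inner ℝ (u : TangentSpace 𝓘(ℝ, E) x) (leviCivita X x v))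
      (fun u u' v => by simp only [Submodule.coe_add, inner_add_left])
      (fun a u v => by simp only [Submodule.coe_smul, real_inner_smul_left, smul_eq_mul])
      (fun u v v' => by simp only [Submodule.coe_add, leviCivita_add_right hX, inner_add_right])
      (fun a u v => by simp only [Submodule.coe_smul, leviCivita_smul_right hX,
        real_inner_smul_right, smul_eq_mul])
  have h := OrthonormalBasis.sum_bilin_eq B (stdOrthonormalBasis ℝ (F.tangent x)) b
  simp only [B, LinearMap.mk₂_apply, hb] at h
  exact h

theorem meanCurvature_mem (x : M) : F.meanCurvature x ∈ (F.tangent x)ᗮ :=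
  Submodule.smul_mem _ _ (Submodule.sum_mem _ fun _ _ => F.secondFundamentalForm_mem _ _)

theorem eventually_meanCurvature_eq {e : ι → Π x : M, TangentSpace 𝓘(ℝ, E) x}
    (he : IsOrthonormalFrameAt F.tangent e x) :
    ∀ᶠ y in 𝓝 x, F.meanCurvature y =
      (k : ℝ)⁻¹ • ∑ i, (F.tangent y)ᗮ.starProjection (leviCivita (e i) y (e i y)) := by
  have h1 : ∀ᶠ y in 𝓝 x, ∀ i, MDiffAt (T% (e i)) y :=
    Filter.eventually_all.2 fun i => (he.smooth i).eventually_mdifferentiableAt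
  have h2 : ∀ᶠ y in 𝓝 x, ∀ i, ∀ᶠ z in 𝓝 y, e i z ∈ F.tangent z :=
    Filter.eventually_all.2 fun i => eventually_eventually_nhds.2 (he.mem i)
  filter_upwards [h1, h2, he.orthonormal, he.span_eq] with y h1 h2 h3 h4
  rw [F.meanCurvature_eq_sum h3 h4]
  simp only [F.secondFundamentalForm_eq (h1 _) (h2 _)]

theorem smooth_meanCurvature (x : M) : SmoothFieldAt F.meanCurvature x := by
  obtain ⟨e, he⟩ := F.exists_orthonormalFrame x
  refine SmoothFieldAt.congr (SmoothFieldAt.const_smul _ (SmoothFieldAt.sum (s := Finset.univ)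
    (X := fun i y => (F.tangent y)ᗮ.starProjection (leviCivita (e i) y (e i y))) fun i _ =>
      F.smooth_starProjection_orthogonal ((he.smooth i).covariantDerivative (he.smooth i))))
    (F.eventually_meanCurvature_eq he)

end Foliation

/-! ### Mixed sectional curvatures -/

section MixedCurvature

variable {E : Type*} [NormedAddCommGroup E] [NormedSpace ℝ E] [FiniteDimensional ℝ E]
  {M : Type*} [TopologicalSpace M] [ChartedSpace E M] [IsManifold 𝓘(ℝ, E) ∞ M]
  [Bundle.RiemannianBundle (fun x : M => TangentSpace 𝓘(ℝ, E) x)]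
  [IsContMDiffRiemannianBundle 𝓘(ℝ, E) ∞ E (fun x : M => TangentSpace 𝓘(ℝ, E) x)]
  {k q : ℕ} {x : M}

theorem mvfderiv_sum_apply {ι : Type*} (s : Finset ι) {f : ι → M → ℝ}
    (hf : ∀ i ∈ s, MDiffAt (f i) x) (u : TangentSpace 𝓘(ℝ, E) x) :
    mvfderiv 𝓘(ℝ, E) (fun y => ∑ i ∈ s, f i y) x u = ∑ i ∈ s, mvfderiv 𝓘(ℝ, E) (f i) x u := by
  classical
  suffices h : MDiffAt (fun y => ∑ i ∈ s, f i y) x ∧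
      mvfderiv 𝓘(ℝ, E) (fun y => ∑ i ∈ s, f i y) x u = ∑ i ∈ s, mvfderiv 𝓘(ℝ, E) (f i) x u from h.2
  induction s using Finset.induction_on with
  | empty => simp [mdifferentiableAt_const, mvfderiv_const]
  | insert a s ha ih =>
    obtain ⟨h1, h2⟩ := ih fun i hi => hf i (Finset.mem_insert_of_mem hi)
    have h3 := hf a (Finset.mem_insert_self _ _)
    simp only [Finset.sum_insert ha]
    exact ⟨h3.add h1, by rw [mvfderiv_fun_add h3 h1, add_apply, h2]⟩

/-- The covariant derivative of a field at a point as a linear map. -/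
noncomputable def leviCivitaLinear {Y : Π x : M, TangentSpace 𝓘(ℝ, E) x} (hY : MDiffAt (T% Y) x) :
    TangentSpace 𝓘(ℝ, E) x →ₗ[ℝ] TangentSpace 𝓘(ℝ, E) x where
  toFun := leviCivita Y x
  map_add' := leviCivita_add_right hY
  map_smul' := leviCivita_smul_right hY

theorem leviCivitaLinear_apply {Y : Π x : M, TangentSpace 𝓘(ℝ, E) x} (hY : MDiffAt (T% Y) x)
    (u : TangentSpace 𝓘(ℝ, E) x) : leviCivitaLinear hY u = leviCivita Y x u := rfl

namespace Foliation

variable {F : Foliation E M k q} {G : Foliation E M q k}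

/-- The unnormalized mean curvature vector `∑ᵢ (∇_{eᵢ} eᵢ)^⊥` of the leaves. -/
noncomputable def totalMeanCurvature (F : Foliation E M k q) (x : M) : TangentSpace 𝓘(ℝ, E) x :=
  (k : ℝ) • F.meanCurvature x

theorem smooth_totalMeanCurvature (F : Foliation E M k q) (x : M) :
    SmoothFieldAt F.totalMeanCurvature x :=
  (F.smooth_meanCurvature x).const_smul _

theorem totalMeanCurvature_mem (F : Foliation E M k q) (x : M) :
    F.totalMeanCurvature x ∈ (F.tangent x)ᗮ :=
  Submodule.smul_mem _ _ (F.meanCurvature_mem x)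

theorem totalMeanCurvature_eq_sum {ι : Type*} [Fintype ι] {e : ι → TangentSpace 𝓘(ℝ, E) x}
    (he : Orthonormal ℝ e) (hspan : Submodule.span ℝ (Set.range e) = F.tangent x) :
    F.totalMeanCurvature x = ∑ i, F.secondFundamentalForm x (e i) (e i) := by
  rw [totalMeanCurvature, F.meanCurvature_eq_sum he hspan, smul_smul]
  rcases Nat.eq_zero_or_pos k with rfl | hk
  · have : Module.finrank ℝ (F.tangent x) = 0 := by
      obtain ⟨e', he'⟩ := F.exists_orthonormalFrame x
      rw [← he'.span_eq.self_of_nhds, Set.range_eq_empty, Submodule.span_empty, finrank_bot]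
    rw [← hspan, finrank_span_eq_card he.linearIndependent] at this
    have := Fintype.card_eq_zero_iff.1 this
    simp
  · rw [mul_inv_cancel₀ (by positivity), one_smul]

/-- If the leaves of `G` are totally umbilical, then the normal component of `∇_u T` is
`⟨u, T⟩ h` for every field `T` tangent to `G`. -/
theorem IsTotallyUmbilical.inner_leviCivita (hG : G.IsTotallyUmbilical)
    {T : Π x : M, TangentSpace 𝓘(ℝ, E) x} (hT : MDiffAt (T% T) x)
    (hTG : ∀ᶠ y in 𝓝 x, T y ∈ G.tangent y) {u w : TangentSpace 𝓘(ℝ, E) x} (hu : u ∈ G.tangent x)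
    (hw : w ∈ (G.tangent x)ᗮ) :
    (inner ℝ (leviCivita T x u) w : ℝ) = inner ℝ u (T x) * inner ℝ (G.meanCurvature x) w := by
  rw [← G.inner_secondFundamentalForm hT hTG u hw, hG x u hu _ hTG.self_of_nhds,
    real_inner_smul_left]

/-- The sum of the normal components of `∇_{eᵢ} eᵢ` is the unnormalized mean curvature vector. -/
theorem eventually_sum_inner_leviCivita {e : Fin k → Π x : M, TangentSpace 𝓘(ℝ, E) x}
    (he : IsOrthonormalFrameAt F.tangent e x) :
    ∀ᶠ y in 𝓝 x, ∀ w ∈ (F.tangent y)ᗮ, ∑ i, (inner ℝ w (leviCivita (e i) y (e i y)) : ℝ)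
      = inner ℝ w (F.totalMeanCurvature y) := by
  filter_upwards [F.eventually_meanCurvature_eq he] with y hy w hw
  have h1 : F.totalMeanCurvature y =
      ∑ i, (F.tangent y)ᗮ.starProjection (leviCivita (e i) y (e i y)) := by
    rw [totalMeanCurvature, hy, smul_smul]
    rcases Nat.eq_zero_or_pos k with rfl | hk
    · simp
    · rw [mul_inv_cancel₀ (by positivity), one_smul]
  rw [h1, inner_sum]
  refine Finset.sum_congr rfl fun i _ => ?_
  rw [← Submodule.inner_starProjection_left_eq_right, Submodule.starProjection_eq_self_iff.2 hw]

/-- Let `F` and `G` be orthogonal foliations of a manifold of constant curvature `c`, such that the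
leaves of `G` are totally umbilical with mean curvature vector `h`, let `Z` be the unnormalized mean
curvature vector of the leaves of `F`, and let `T` be tangent to `G`. The sum of the mixed
sectional curvatures `⟨R(eᵢ, T) T, eᵢ⟩` over an orthonormal frame of `F` is a Riccati expression in
the shape operator of `F` in the direction `T`; the trace of that operator is `⟨T, Z⟩`, whence the
derivative of `Z`. -/
theorem mixed_curvature_identity {c : ℝ} (hcurv : HasConstantCurvature E M c)
    (horth : ∀ x : M, G.tangent x = (F.tangent x)ᗮ) (hG : G.IsTotallyUmbilical)
    {e : Fin k → Π x : M, TangentSpace 𝓘(ℝ, E) x} (he : IsOrthonormalFrameAt F.tangent e x)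
    {T : Π x : M, TangentSpace 𝓘(ℝ, E) x} (hT : SmoothFieldAt T x)
    (hTG : ∀ᶠ y in 𝓝 x, T y ∈ G.tangent y) :
    k * c * ‖T x‖ ^ 2 = ‖T x‖ ^ 2 * (F.divergence G.meanCurvature x - ‖G.meanCurvature x‖ ^ 2)
      + inner ℝ (T x) (leviCivita F.totalMeanCurvature x (T x))
      - ∑ i, ∑ j, (inner ℝ (T x) (F.secondFundamentalForm x (e i x) (e j x)) : ℝ) ^ 2 := by
  set h := G.meanCurvature with hh
  set Z := F.totalMeanCurvature with hZdef
  have hZ : SmoothFieldAt Z x := F.smooth_totalMeanCurvature x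
  have hhs : SmoothFieldAt h x := G.smooth_meanCurvature x
  have hes := he.smooth
  have hGF : ∀ y, (G.tangent y)ᗮ = F.tangent y := fun y => by
    rw [horth, Submodule.orthogonal_orthogonal]
  have heF : ∀ i, ∀ᶠ y in 𝓝 x, e i y ∈ F.tangent y := he.mem
  have heT : ∀ i, ∀ᶠ y in 𝓝 x, (inner ℝ (e i y) (T y) : ℝ) = 0 := fun i => by
    filter_upwards [heF i, hTG] with y h1 h2
    rw [horth] at h2
    exact h2 _ h1
  have heT' : ∀ i, ∀ᶠ y in 𝓝 x, (inner ℝ (T y) (e i y) : ℝ) = 0 := fun i =>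
    (heT i).mono fun y hy => by rw [real_inner_comm, hy]
  have hed := fun i => (hes i).mdifferentiableAt
  have hTd := hT.mdifferentiableAt
  have heTx := fun i => (heT i).self_of_nhds
  have heTx' := fun i => (heT' i).self_of_nhds
  have hon := orthonormal_iff_ite.1 he.orthonormal.self_of_nhds
  have hDee : ∀ i, SmoothFieldAt (fun y => leviCivita (e i) y (e i y)) x := fun i =>
    (hes i).covariantDerivative (hes i)
  have hDTT : SmoothFieldAt (fun y => leviCivita T y (T y)) x := hT.covariantDerivative hT
  have hDeT : ∀ i, SmoothFieldAt (fun y => leviCivita T y (e i y)) x := fun i =>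
    (hes i).covariantDerivative hT
  have hperp : ∀ v : TangentSpace 𝓘(ℝ, E) x, (∀ i, (inner ℝ (e i x) v : ℝ) = 0) →
      v ∈ G.tangent x := by
    intro v hv
    rw [horth, ← he.span_eq.self_of_nhds, Submodule.mem_orthogonal]
    intro u hu
    induction hu using Submodule.span_induction with
    | mem z hz => obtain ⟨j, rfl⟩ := hz; exact hv j
    | zero => simp
    | add a b _ _ ha hb => rw [inner_add_left, ha, hb, add_zero]
    | smul a b _ hb => rw [real_inner_smul_left, hb, mul_zero]
  -- The shape operator `σ` in the direction `T`, the connection coefficients `θ` of the frame along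
  -- `T`, the components `η` of `h`, and auxiliary functions `t` that cancel in the end.
  set σ : Fin k → Fin k → ℝ := fun i j =>
    inner ℝ (T x) (F.secondFundamentalForm x (e i x) (e j x)) with hσ
  set θ : Fin k → Fin k → ℝ := fun i j => inner ℝ (e j x) (leviCivita (e i) x (T x)) with hθ
  set η : Fin k → ℝ := fun i => inner ℝ (h x) (e i x) with hη
  set t : Fin k → ℝ := fun i => inner ℝ (leviCivita T x (e i x)) (T x) with ht
  have hσs : ∀ i j, σ i j = σ j i := fun i j => by
    simp only [hσ]
    rw [F.secondFundamentalForm_comm (heF i).self_of_nhds (heF j).self_of_nhds]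
  have hθs : ∀ i j, θ i j = -θ j i := fun i j => by
    have := inner_leviCivita_eq_neg (hed i) (hed j) (a := if i = j then 1 else 0)
      (he.orthonormal.mono fun y hy => orthonormal_iff_ite.1 hy i j) (T x)
    simp only [hθ]
    rw [real_inner_comm, this]
  have hTx : T x ∈ (F.tangent x)ᗮ := horth x ▸ hTG.self_of_nhds
  -- The `F`-component of `∇_{e_j} T`.
  have hlcT : ∀ i j, (inner ℝ (leviCivita T x (e j x)) (e i x) : ℝ) = -σ j i := fun i j => by
    rw [inner_leviCivita_eq_neg (a := 0) hTd (hed i) (heT' i), real_inner_comm,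
      ← F.inner_secondFundamentalForm (hed i) (heF i) _ hTx, real_inner_comm]
  have hDTTi : ∀ i, ∀ᶠ y in 𝓝 x, (inner ℝ (leviCivita T y (T y)) (e i y) : ℝ)
      = inner ℝ (T y) (T y) * inner ℝ (h y) (e i y) := fun i => by
    filter_upwards [hT.eventually_mdifferentiableAt, eventually_eventually_nhds.2 hTG, heF i]
      with y h1 h2 h3
    exact hG.inner_leviCivita h1 h2 h2.self_of_nhds (by rwa [hGF])
  have hei : ∀ i, e i x ∈ (G.tangent x)ᗮ := fun i => by rw [hGF]; exact (heF i).self_of_nhds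
  have hsumT : ∀ (f : Fin k → ℝ) (l : Fin k),
      (inner ℝ (e l x) (∑ j, f j • e j x) : ℝ) = f l := fun f l => by
    simp only [inner_sum, real_inner_smul_right, hon]
    simp
  -- The `F`-component of `∇_v T` for general `v`: the part of `v` tangent to `F` contributes the
  -- shape operator, and the part tangent to `G` contributes `⟨v, T⟩ h` because `G` is umbilical.
  have hlc : ∀ (v : TangentSpace 𝓘(ℝ, E) x) i, (inner ℝ (leviCivita T x v) (e i x) : ℝ)
      = -∑ j, (inner ℝ (e j x) v : ℝ) * σ j i + inner ℝ v (T x) * η i := by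
    intro v i
    set w := v - ∑ j, (inner ℝ (e j x) v : ℝ) • e j x with hw
    have hwG : w ∈ G.tangent x := hperp w fun l => by rw [hw, inner_sub_right, hsumT, sub_self]
    have hv : v = ∑ j, (inner ℝ (e j x) v : ℝ) • e j x + w := by rw [hw]; abel
    have hwT : (inner ℝ w (T x) : ℝ) = inner ℝ v (T x) := by
      rw [hw, inner_sub_left, sum_inner]
      simp [real_inner_smul_left, heTx]
    have h1 := hG.inner_leviCivita hTd hTG hwG (hei i)
    conv_lhs => rw [hv]
    rw [← leviCivitaLinear_apply hTd, map_add, map_sum, inner_add_left, sum_inner]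
    simp only [map_smul, real_inner_smul_left, leviCivitaLinear_apply, hlcT, h1, hwT]
    simp [hη, hh]
  -- The `G`-component of `∇_T eᵢ` is `-ηᵢ T`, again because `G` is umbilical: the difference `v` of
  -- both sides is tangent to `G`, and pairing with an extension of `v` shows that `|v|² = 0`.
  have hb : ∀ i, leviCivita (e i) x (T x) = ∑ j, θ i j • e j x - η i • T x := by
    intro i
    obtain ⟨v, hv⟩ : ∃ v, v = leviCivita (e i) x (T x) - (∑ j, θ i j • e j x - η i • T x) :=
      ⟨_, rfl⟩
    have h1 : ∀ l, (inner ℝ (e l x) v : ℝ) = 0 := fun l => by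
      rw [hv, inner_sub_right, inner_sub_right, hsumT, real_inner_smul_right, heTx]
      simp [hθ]
    obtain ⟨V, hV, hVG, hVx⟩ := G.exists_smooth_extension (hperp v h1)
    have h2 := inner_leviCivita_eq_neg (a := 0) (hed i) hV.mdifferentiableAt
      ((heF i).mono fun y hy => by
        have := hVG y
        rw [horth] at this
        exact this _ hy) (T x)
    rw [real_inner_comm _ (e i x), hG.inner_leviCivita hV.mdifferentiableAt (.of_forall hVG)
      hTG.self_of_nhds (hei i), hVx] at h2
    have h3 : (inner ℝ v v : ℝ) = 0 :=
      calc (inner ℝ v v : ℝ)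
          = inner ℝ (leviCivita (e i) x (T x) - (∑ j, θ i j • e j x - η i • T x)) v := by rw [← hv]
        _ = 0 := by
          rw [inner_sub_left, inner_sub_left, h2, sum_inner]
          simp only [real_inner_smul_left, h1, mul_zero, Finset.sum_const_zero, hη, hh]
          ring
    rw [hv] at h3
    exact sub_eq_zero.1 (inner_self_eq_zero.1 h3)
  -- The curvature identity for each vector of the frame. The term `⟨∇_{eᵢ} ∇_T T, eᵢ⟩` comes from
  -- differentiating `⟨∇_T T, eᵢ⟩ = |T|² ηᵢ` (`m1`), the term `⟨∇_T ∇_{eᵢ} T, eᵢ⟩` from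
  -- differentiating `⟨∇_{eᵢ} T, eᵢ⟩` (`m2`), and the term `⟨∇_{[eᵢ, T]} T, eᵢ⟩` from
  -- `[eᵢ, T] = ∇_{eᵢ} T - ∇_T eᵢ` and `hlc`.
  have hcu : ∀ i, c * ‖T x‖ ^ 2 = ‖T x‖ ^ 2 * (inner ℝ (e i x) (leviCivita h x (e i x)) : ℝ)
      + inner ℝ (‖T x‖ ^ 2 • h x - leviCivita T x (T x)) (leviCivita (e i) x (e i x))
      - mvfderiv 𝓘(ℝ, E) (fun y => (inner ℝ (leviCivita T y (e i y)) (e i y) : ℝ)) x (T x)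
      - ∑ j, σ i j ^ 2 - ‖T x‖ ^ 2 * η i ^ 2 - 2 * ∑ j, θ i j * σ i j := by
    intro i
    have hR := hcurv x (e i) T (hes i) hT
    rw [curvature, inner_sub_left, inner_sub_left,
      ← leviCivita_sub_leviCivita (hed i) hTd, ← leviCivitaLinear_apply hTd (_ - _), map_sub,
      inner_sub_left, leviCivitaLinear_apply, leviCivitaLinear_apply, hlc, hlc, heTx] at hR
    have m1 := mvfderiv_inner hDTT.mdifferentiableAt (hed i) (e i x)
    rw [(show _ =ᶠ[𝓝 x] _ from hDTTi i).mvfderiv_eq,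
      mvfderiv_fun_mul (mdifferentiableAt_inner hTd hTd)
        (mdifferentiableAt_inner hhs.mdifferentiableAt (hed i)), add_apply, smul_apply, smul_apply,
      mvfderiv_inner hTd hTd, mvfderiv_inner hhs.mdifferentiableAt (hed i)] at m1
    have m2 := mvfderiv_inner (hDeT i).mdifferentiableAt (hed i) (T x)
    have hab : (inner ℝ (leviCivita T x (e i x)) (leviCivita (e i) x (T x)) : ℝ)
        = -∑ j, θ i j * σ i j - η i * t i := by
      rw [hb, inner_sub_right, inner_sum]
      simp only [real_inner_smul_right, hlcT, mul_neg, Finset.sum_neg_distrib]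
      rfl
    have hbT : (inner ℝ (leviCivita (e i) x (T x)) (T x) : ℝ) = -η i * ‖T x‖ ^ 2 := by
      rw [hb, inner_sub_left, sum_inner]
      simp [real_inner_smul_left, heTx]
    have s1 : ∑ j, (inner ℝ (e j x) (leviCivita T x (e i x)) : ℝ) * σ j i = -∑ j, σ i j ^ 2 := by
      rw [← Finset.sum_neg_distrib]
      refine Finset.sum_congr rfl fun j _ => ?_
      rw [real_inner_comm, hlcT, hσs j i]
      ring
    have s2 : ∑ j, (inner ℝ (e j x) (leviCivita (e i) x (T x)) : ℝ) * σ j i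
        = ∑ j, θ i j * σ i j := Finset.sum_congr rfl fun j _ => by rw [hσs j i]
    have hn : ‖e i x‖ = 1 := he.orthonormal.self_of_nhds.1 i
    rw [s1, s2, hbT, hn] at hR
    rw [hab] at m2
    rw [real_inner_comm (leviCivita T x (e i x)) (T x)] at m1
    rw [inner_sub_left, real_inner_smul_left, real_inner_comm _ (e i x)]
    simp only [real_inner_self_eq_norm_sq, smul_eq_mul] at m1
    simp only [hη, ht] at *
    linear_combination - hR - m1 + m2
  have hw : ‖T x‖ ^ 2 • h x - leviCivita T x (T x) ∈ (F.tangent x)ᗮ := by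
    rw [← horth]
    refine hperp _ fun i => ?_
    rw [inner_sub_right, real_inner_smul_right, real_inner_comm (leviCivita T x (T x)),
      (hDTTi i).self_of_nhds, real_inner_self_eq_norm_sq, real_inner_comm (h x), sub_self]
  -- Summation over the frame: `∑ᵢ (∇_{eᵢ} eᵢ)^⊥ = Z`.
  have hsum := F.eventually_sum_inner_leviCivita he
  have hhF : h x ∈ F.tangent x := by
    have := G.meanCurvature_mem x
    rwa [hGF] at this
  have hZG : Z x ∈ (F.tangent x)ᗮ := F.totalMeanCurvature_mem x
  have e1 : ∑ i, (inner ℝ (‖T x‖ ^ 2 • h x - leviCivita T x (T x))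
      (leviCivita (e i) x (e i x)) : ℝ) = -inner ℝ (leviCivita T x (T x)) (Z x) := by
    rw [hsum.self_of_nhds _ hw, inner_sub_left, real_inner_smul_left]
    change _ * inner ℝ (h x) (Z x) - inner ℝ _ (Z x) = _
    rw [hZG _ hhF, mul_zero, zero_sub]
  have e2 : ∑ i, mvfderiv 𝓘(ℝ, E) (fun y => (inner ℝ (leviCivita T y (e i y)) (e i y) : ℝ)) x (T x)
      = -(inner ℝ (leviCivita T x (T x)) (Z x) + inner ℝ (T x) (leviCivita Z x (T x))) := by
    rw [← mvfderiv_sum_apply _ fun i _ =>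
        mdifferentiableAt_inner (hDeT i).mdifferentiableAt (hed i),
      ← mvfderiv_inner hTd hZ.mdifferentiableAt]
    have : (fun y => ∑ i, (inner ℝ (leviCivita T y (e i y)) (e i y) : ℝ)) =ᶠ[𝓝 x]
        fun y => -inner ℝ (T y) (Z y) := by
      have h1 : ∀ᶠ y in 𝓝 x, ∀ i, (inner ℝ (leviCivita T y (e i y)) (e i y) : ℝ)
          = -inner ℝ (T y) (leviCivita (e i) y (e i y)) := by
        refine Filter.eventually_all.2 fun i => ?_
        filter_upwards [hT.eventually_mdifferentiableAt, (hes i).eventually_mdifferentiableAt,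
          eventually_eventually_nhds.2 (heT' i)] with y h1 h2 h3
        exact inner_leviCivita_eq_neg h1 h2 h3 _
      filter_upwards [h1, hsum, hTG] with y h1 h2 h3
      rw [horth] at h3
      rw [Finset.sum_congr rfl fun i _ => h1 i, Finset.sum_neg_distrib, h2 _ h3]
    rw [this.mvfderiv_eq, mvfderiv_fun_neg]
    simp
  have e3 : ∑ i, η i ^ 2 = ‖h x‖ ^ 2 := by
    have hhe : h x = ∑ i, η i • e i x := by
      refine sub_eq_zero.1 (inner_self_eq_zero (𝕜 := ℝ).1 ?_)
      have h1 : h x - ∑ i, η i • e i x ∈ G.tangent x := hperp _ fun l => by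
        rw [inner_sub_right, hsumT, hη, real_inner_comm, sub_self]
      rw [horth] at h1
      refine h1 _ (Submodule.sub_mem _ hhF (Submodule.sum_mem _ fun i _ =>
        Submodule.smul_mem _ _ (heF i).self_of_nhds))
    calc ∑ i, η i ^ 2 = inner ℝ (h x) (∑ i, η i • e i x) := by
          rw [inner_sum]
          exact Finset.sum_congr rfl fun i _ => by rw [real_inner_smul_right, pow_two]
      _ = ‖h x‖ ^ 2 := by rw [← hhe, real_inner_self_eq_norm_sq]
  -- `θ` is antisymmetric and `σ` is symmetric.
  have e4 : ∑ i, ∑ j, θ i j * σ i j = 0 := by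
    have : ∑ i, ∑ j, θ i j * σ i j = -∑ i, ∑ j, θ i j * σ i j := by
      conv_lhs => rw [Finset.sum_comm]
      rw [← Finset.sum_neg_distrib]
      refine Finset.sum_congr rfl fun i _ => ?_
      rw [← Finset.sum_neg_distrib]
      refine Finset.sum_congr rfl fun j _ => ?_
      rw [hθs j i, hσs j i, neg_mul]
    linarith
  have e5 : F.divergence h x = ∑ i, inner ℝ (e i x) (leviCivita h x (e i x)) :=
    F.divergence_eq_sum he.orthonormal.self_of_nhds he.span_eq.self_of_nhds hhs.mdifferentiableAt
  have := Finset.sum_congr rfl fun i (_ : i ∈ (Finset.univ : Finset (Fin k))) => hcu i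
  simp only [Finset.sum_sub_distrib, Finset.sum_add_distrib, ← Finset.mul_sum, e1, e2, e3, e4, ← e5,
    Finset.sum_const, Finset.card_univ, Fintype.card_fin, nsmul_eq_mul] at this
  linear_combination this

/-- Where the divergence of `h` is at most `k c`, the unnormalized mean curvature vector `Z` of `F`
satisfies the Riccati inequality `⟨∇_Z Z, Z⟩ ≥ |Z|⁴ / k`. -/
theorem riccati_totalMeanCurvature {c : ℝ} (hcurv : HasConstantCurvature E M c)
    (horth : ∀ x : M, G.tangent x = (F.tangent x)ᗮ) (hG : G.IsTotallyUmbilical)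
    (hdiv : F.divergence G.meanCurvature x ≤ k * c) :
    ‖F.totalMeanCurvature x‖ ^ 4
      ≤ k * inner ℝ (F.totalMeanCurvature x)
        (leviCivita F.totalMeanCurvature x (F.totalMeanCurvature x)) := by
  obtain ⟨e, he⟩ := F.exists_orthonormalFrame x
  have h1 := mixed_curvature_identity hcurv horth hG he (F.smooth_totalMeanCurvature x)
    (.of_forall fun y => by rw [horth]; exact F.totalMeanCurvature_mem y)
  set Z := F.totalMeanCurvature
  set S : Fin k → Fin k → ℝ := fun i j => inner ℝ (Z x) (F.secondFundamentalForm x (e i x) (e j x))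
  have h2 : ‖Z x‖ ^ 2 = ∑ i, S i i := by
    rw [← real_inner_self_eq_norm_sq]
    nth_rewrite 2 [show Z x = ∑ i, F.secondFundamentalForm x (e i x) (e i x) from
      totalMeanCurvature_eq_sum he.orthonormal.self_of_nhds he.span_eq.self_of_nhds]
    rw [inner_sum]
  have h3 : (∑ i, S i i) ^ 2 ≤ k * ∑ i, S i i ^ 2 := by
    have := sq_sum_le_card_mul_sum_sq (s := (Finset.univ : Finset (Fin k))) (f := fun i => S i i)
    simpa using this
  have h4 : ∑ i, S i i ^ 2 ≤ ∑ i, ∑ j, S i j ^ 2 := Finset.sum_le_sum fun i _ =>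
    Finset.single_le_sum (f := fun j => S i j ^ 2) (fun j _ => sq_nonneg _) (Finset.mem_univ i)
  have h5 : 0 ≤ ‖Z x‖ ^ 2 * (k * c - F.divergence G.meanCurvature x) :=
    mul_nonneg (sq_nonneg _) (sub_nonneg.2 hdiv)
  have h6 : 0 ≤ ‖Z x‖ ^ 2 * ‖G.meanCurvature x‖ ^ 2 := by positivity
  calc ‖Z x‖ ^ 4 = (‖Z x‖ ^ 2) ^ 2 := by ring
    _ ≤ k * ∑ i, S i i ^ 2 := by rw [h2]; exact h3
    _ ≤ _ := mul_le_mul_of_nonneg_left (by linarith) k.cast_nonneg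

/-- If `Z` is parallel at `x` along `G`, then the other terms of the mixed curvature identity all
have the same sign and hence vanish. -/
theorem rigidity_of_parallel {c : ℝ} (hcurv : HasConstantCurvature E M c)
    (horth : ∀ x : M, G.tangent x = (F.tangent x)ᗮ) (hG : G.IsTotallyUmbilical)
    (hdiv : F.divergence G.meanCurvature x ≤ k * c)
    (hZ : ∀ v ∈ G.tangent x, leviCivita F.totalMeanCurvature x v = 0) :
    (∀ u ∈ F.tangent x, ∀ v ∈ F.tangent x, F.secondFundamentalForm x u v = 0) ∧
      ∀ v ∈ G.tangent x, v ≠ 0 →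
        G.meanCurvature x = 0 ∧ F.divergence G.meanCurvature x = k * c := by
  obtain ⟨e, he⟩ := F.exists_orthonormalFrame x
  have key : ∀ v ∈ G.tangent x,
      ‖v‖ ^ 2 * (k * c - F.divergence G.meanCurvature x) = 0 ∧
      ‖v‖ ^ 2 * ‖G.meanCurvature x‖ ^ 2 = 0 ∧
      ∀ i j, (inner ℝ v (F.secondFundamentalForm x (e i x) (e j x)) : ℝ) = 0 := by
    intro v hv
    obtain ⟨V, hV, hVG, rfl⟩ := G.exists_smooth_extension hv
    have h1 := mixed_curvature_identity hcurv horth hG he hV (.of_forall hVG)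
    rw [hZ _ hv, inner_zero_right] at h1
    have h3 : 0 ≤ ∑ i, ∑ j, (inner ℝ (V x) (F.secondFundamentalForm x (e i x) (e j x)) : ℝ) ^ 2 :=
      Finset.sum_nonneg fun i _ => Finset.sum_nonneg fun j _ => sq_nonneg _
    have h5 : 0 ≤ ‖V x‖ ^ 2 * (k * c - F.divergence G.meanCurvature x) :=
      mul_nonneg (sq_nonneg _) (sub_nonneg.2 hdiv)
    have h6 : 0 ≤ ‖V x‖ ^ 2 * ‖G.meanCurvature x‖ ^ 2 := by positivity
    refine ⟨by linarith, by linarith, fun i j => ?_⟩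
    have h7 : ∑ i, ∑ j,
        (inner ℝ (V x) (F.secondFundamentalForm x (e i x) (e j x)) : ℝ) ^ 2 = 0 := by linarith
    rw [Finset.sum_eq_zero_iff_of_nonneg fun i _ => Finset.sum_nonneg fun j _ => sq_nonneg _] at h7
    have h8 := h7 i (Finset.mem_univ _)
    rw [Finset.sum_eq_zero_iff_of_nonneg fun j _ => sq_nonneg _] at h8
    exact pow_eq_zero_iff two_ne_zero |>.1 (h8 j (Finset.mem_univ _))
  have hS : ∀ i j, F.secondFundamentalForm x (e i x) (e j x) = 0 := fun i j => by
    have h1 := F.secondFundamentalForm_mem (x := x) (e i x) (e j x)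
    rw [← horth] at h1
    exact inner_self_eq_zero.1 ((key _ h1).2.2 i j)
  refine ⟨fun u hu v hv => ?_, fun v hv hv0 => ?_⟩
  · have he' : ∀ i, e i x ∈ F.tangent x := fun i => (he.mem i).self_of_nhds
    have hspan : Submodule.span ℝ (Set.range fun i => (⟨e i x, he' i⟩ : F.tangent x)) = ⊤ := by
      apply Submodule.map_injective_of_injective (F.tangent x).subtype_injective
      rw [Submodule.map_span, Submodule.map_top, Submodule.range_subtype, ← Set.range_comp]
      exact he.span_eq.self_of_nhds
    have h0 : F.sffBilin x = 0 :=
      LinearMap.ext_on_range hspan fun i => LinearMap.ext_on_range hspan fun j => hS i j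
    exact congrArg (fun f => f ⟨u, hu⟩ ⟨v, hv⟩) h0
  · have hv1 : ‖v‖ ^ 2 ≠ 0 := pow_ne_zero _ (norm_ne_zero_iff.2 hv0)
    obtain ⟨h1, h2, -⟩ := key v hv
    refine ⟨by simpa [hv1] using h2, ?_⟩
    have := (mul_eq_zero.1 h1).resolve_left hv1
    linarith

/-- The leaves of a foliation by curves are totally umbilical. -/
theorem isTotallyUmbilical_of_dim_one (F : Foliation E M 1 q) : F.IsTotallyUmbilical := by
  intro x u hu v hv
  obtain ⟨e, he⟩ := F.exists_orthonormalFrame x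
  -- Both sides are bilinear and the tangent space of the leaf is spanned by `e 0`.
  have hspan := he.span_eq.self_of_nhds
  have hon := he.orthonormal.self_of_nhds
  rw [F.meanCurvature_eq_sum hon hspan]
  have he0 : e 0 x ∈ F.tangent x := (he.mem 0).self_of_nhds
  have h1 : ∀ w ∈ F.tangent x, ∃ a : ℝ, a • e 0 x = w := fun w hw => by
    rw [← hspan, show Set.range (fun i => e i x) = {e 0 x} by
      ext z; simp [Fin.exists_fin_one, eq_comm]] at hw
    exact Submodule.mem_span_singleton.1 hw
  obtain ⟨a, rfl⟩ := h1 u hu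
  obtain ⟨b, rfl⟩ := h1 v hv
  have h2 : F.secondFundamentalForm x (a • e 0 x) (b • e 0 x)
      = a • b • F.secondFundamentalForm x (e 0 x) (e 0 x) := by
    have := (F.sffBilin x).map_smul₂ a ⟨e 0 x, he0⟩ (b • ⟨e 0 x, he0⟩)
    rwa [map_smul (F.sffBilin x ⟨e 0 x, he0⟩)] at this
  rw [h2, real_inner_smul_left, real_inner_smul_right, real_inner_self_eq_norm_sq, hon.1 0]
  simp [smul_smul]

end Foliation

end MixedCurvature

/-! ### Integral curves in charts -/

section IntegralCurves

open VectorField Set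

variable {E : Type*} [NormedAddCommGroup E] [NormedSpace ℝ E] [FiniteDimensional ℝ E]
  {M : Type*} [TopologicalSpace M] [ChartedSpace E M] [IsManifold 𝓘(ℝ, E) ∞ M]

/-- The expression of a vector field in a chart. -/
noncomputable def chartField (φ : OpenPartialHomeomorph M E) (X : Π x : M, TangentSpace 𝓘(ℝ, E) x) :
    E → E :=
  fun z => (mfderiv 𝓘(ℝ, E) 𝓘(ℝ, E) φ (φ.symm z) (X (φ.symm z)) : E)

theorem mdifferentiable_chartAt (y : M) : (chartAt E y).MDifferentiable 𝓘(ℝ, E) 𝓘(ℝ, E) :=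
  ⟨(contMDiffOn_chart (n := ∞)).mdifferentiableOn (by simp),
    (contMDiffOn_chart_symm (n := ∞)).mdifferentiableOn (by simp)⟩

variable {X : Π x : M, TangentSpace 𝓘(ℝ, E) x}

theorem chartField_apply (φ : OpenPartialHomeomorph M E) {x : M} (hx : x ∈ φ.source) :
    chartField φ X (φ x) = (mfderiv 𝓘(ℝ, E) 𝓘(ℝ, E) φ x (X x) : E) :=
  congrArg (fun p => (mfderiv 𝓘(ℝ, E) 𝓘(ℝ, E) φ p (X p) : E)) (φ.left_inv hx)

theorem contDiffOn_chartField (hX : ∀ x, SmoothFieldAt X x) (y : M) :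
    ContDiffOn ℝ ∞ (chartField (chartAt E y) X) (chartAt E y).target := by
  intro z hz
  have hφ := mdifferentiable_chartAt (E := E) y
  have h1 : ContMDiffAt 𝓘(ℝ, E) (𝓘(ℝ, E).prod 𝓘(ℝ, E)) ∞
      (T% (mpullback 𝓘(ℝ, E) 𝓘(ℝ, E) (chartAt E y).symm X)) z :=
    ContMDiffAt.mpullback_vectorField_preimage (n := ∞) (hX _)
      ((contMDiffOn_chart_symm _ hz).contMDiffAt ((chartAt E y).open_target.mem_nhds hz))
      ⟨hφ.symm.mfderiv hz, rfl⟩ (by simp)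
  rw [contMDiffAt_vectorSpace_iff_contDiffAt] at h1
  refine (h1.congr_of_eventuallyEq ?_).contDiffWithinAt
  filter_upwards [(chartAt E y).open_target.mem_nhds hz] with w hw
  exact (mpullback_symm_eq_mfderiv hφ hw X).symm

/-- The image in a chart of an integral curve solves the differential equation in the chart. -/
theorem IsMIntegralCurveOn.hasDerivWithinAt_chartAt {γ : ℝ → M} {s : Set ℝ}
    (hγ : IsMIntegralCurveOn γ X s) {y : M} {t : ℝ} (ht : t ∈ s)
    (hy : γ t ∈ (chartAt E y).source) :
    HasDerivWithinAt (chartAt E y ∘ γ) (chartField (chartAt E y) X (chartAt E y (γ t))) s t := by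
  have hφ := mdifferentiable_chartAt (E := E) y
  have h := hasMFDerivWithinAt_iff_hasFDerivWithinAt.1
    ((hφ.mdifferentiableAt hy).hasMFDerivAt.comp_hasMFDerivWithinAt t (hγ t ht))
  rw [hasDerivWithinAt_iff_hasFDerivWithinAt]
  refine h.congr_fderiv (ContinuousLinearMap.ext_ring ?_)
  refine Eq.trans ?_ (one_smul ℝ (chartField (chartAt E y) X (chartAt E y (γ t)))).symm
  rw [chartField_apply _ hy]
  exact congrArg (mfderiv 𝓘(ℝ, E) 𝓘(ℝ, E) (chartAt E y) (γ t)) (one_smul ℝ (X (γ t)))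

/-- The preimage under a chart of a solution of the differential equation in the chart is an
integral curve. -/
theorem hasMFDerivAt_chartAt_symm {α : ℝ → E} {y : M} {t : ℝ}
    (hα : HasDerivAt α (chartField (chartAt E y) X (α t)) t) (ht : α t ∈ (chartAt E y).target) :
    HasMFDerivAt 𝓘(ℝ, ℝ) 𝓘(ℝ, E) ((chartAt E y).symm ∘ α) t
      ((1 : ℝ →L[ℝ] ℝ).smulRight (X ((chartAt E y).symm (α t)))) := by
  have hφ := mdifferentiable_chartAt (E := E) y
  refine ((hφ.mdifferentiableAt_symm ht).hasMFDerivAt.comp t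
    (hasMFDerivAt_iff_hasFDerivAt.2 hα.hasFDerivAt)).congr_mfderiv ?_
  have h := DFunLike.congr_fun (hφ.symm_comp_deriv ((chartAt E y).map_target ht))
    (X ((chartAt E y).symm (α t)))
  rw [(chartAt E y).right_inv ht] at h
  refine ContinuousLinearMap.ext_ring ?_
  refine Eq.trans ?_ (h.trans (one_smul ℝ (X ((chartAt E y).symm (α t)))).symm)
  exact congrArg (mfderiv 𝓘(ℝ, E) 𝓘(ℝ, E) (chartAt E y).symm (α t)) (one_smul ℝ _)

theorem IsMIntegralCurveOn.contMDiffOn (hX : ∀ x, SmoothFieldAt X x) {γ : ℝ → M} {s : Set ℝ}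
    (hs : IsOpen s) (hγ : IsMIntegralCurveOn γ X s) :
    ContMDiffOn 𝓘(ℝ, ℝ) 𝓘(ℝ, E) ∞ γ s := by
  intro t ht
  refine ContMDiffAt.contMDiffWithinAt ?_
  have hc : ContinuousAt γ t := (hγ.continuousWithinAt ht).continuousAt (hs.mem_nhds ht)
  set φ := chartAt E (γ t)
  have h1 : ∀ᶠ r in 𝓝 t, r ∈ s ∧ γ r ∈ φ.source :=
    (hs.eventually_mem ht).and (hc.eventually (φ.open_source.mem_nhds (mem_chart_source E _)))
  obtain ⟨ε, hε, h2⟩ := Metric.nhds_basis_closedBall.eventually_iff.1 h1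
  rw [Real.closedBall_eq_Icc] at h2
  have h3 : ContDiffOn ℝ ∞ (φ ∘ γ) (Icc (t - ε) (t + ε)) := by
    refine ODE.contDiffOn_enat_Icc_of_hasDerivWithinAt (n := ⊤) (u := φ.target)
      (f := fun _ => chartField φ X) ?_ (fun r hr => ?_) (fun r hr => φ.map_source (h2 hr).2)
    · exact (contDiffOn_chartField hX _).comp contDiffOn_snd fun p hp => hp.2
    · exact (hγ.hasDerivWithinAt_chartAt (h2 hr).1 (h2 hr).2).mono fun r' hr' => (h2 hr').1
  have h4 : ContMDiffAt 𝓘(ℝ, ℝ) 𝓘(ℝ, E) ∞ (φ ∘ γ) t :=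
    (h3.contDiffAt (Icc_mem_nhds (by linarith) (by linarith))).contMDiffAt
  have h5 : ContMDiffAt 𝓘(ℝ, ℝ) 𝓘(ℝ, E) ∞ (φ.symm ∘ (φ ∘ γ)) t :=
    ((contMDiffOn_chart_symm _ (φ.map_source (mem_chart_source E _))).contMDiffAt
      (φ.open_target.mem_nhds (φ.map_source (mem_chart_source E _)))).comp t h4
  refine h5.congr_of_eventuallyEq ?_
  filter_upwards [h1] with r hr
  exact (φ.left_inv hr.2).symm

/-- Around each point, the integral curves of a smooth vector field exist for a uniform time. -/
theorem exists_uniform_isMIntegralCurveOn (hX : ∀ x, SmoothFieldAt X x) (y : M) :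
    ∃ ε > (0 : ℝ), ∀ᶠ z in 𝓝 y, ∃ γ : ℝ → M, γ 0 = z ∧ IsMIntegralCurveOn γ X (Ioo (-ε) ε) := by
  set φ := chartAt E y
  have hyt : φ y ∈ φ.target := φ.map_source (mem_chart_source E _)
  have : CompleteSpace E := FiniteDimensional.complete ℝ E
  have h1 : ContDiffAt ℝ 1 (chartField φ X) (φ y) :=
    ((contDiffOn_chartField hX y).contDiffAt (φ.open_target.mem_nhds hyt)).of_le (by simp)
  obtain ⟨ε, hε, a, r, L, K, hr, hPL⟩ := IsPicardLindelof.of_contDiffAt_one h1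
  obtain ⟨α, hα, hαc⟩ := (hPL 0).exists_forall_mem_closedBall_eq_hasDerivWithinAt_continuousOn
  have hr' : (0 : ℝ) < r := hr
  have h2 : ContinuousAt α (φ y, 0) := hαc.continuousAt
    (prod_mem_nhds (Metric.closedBall_mem_nhds _ hr') (Icc_mem_nhds (by simpa) (by simpa)))
  have h3 : ∀ᶠ p in 𝓝 (φ y, (0 : ℝ)), α p ∈ φ.target :=
    h2.eventually (φ.open_target.mem_nhds (by
      rw [(hα _ (Metric.mem_closedBall_self hr'.le)).1]; exact hyt))
  rw [nhds_prod_eq, Filter.eventually_prod_iff] at h3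
  obtain ⟨p, hp, q, hq, hpq⟩ := h3
  obtain ⟨δ, hδ, hq⟩ := Metric.nhds_basis_ball.eventually_iff.1 hq
  refine ⟨min ε δ, lt_min hε hδ, ?_⟩
  have hcont : ContinuousAt φ y := φ.continuousAt (mem_chart_source E _)
  filter_upwards [hcont.eventually hp, hcont.eventually (Metric.closedBall_mem_nhds _ hr'),
    φ.open_source.mem_nhds (mem_chart_source E y)] with z hz1 hz2 hz3
  obtain ⟨hα1, hα2⟩ := hα _ hz2
  refine ⟨φ.symm ∘ fun t => α (φ z, t), ?_, fun t ht => ?_⟩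
  · rw [Function.comp_apply, hα1, φ.left_inv hz3]
  · have ht1 : t ∈ Ioo (0 - ε) (0 + ε) := by
      constructor
      · linarith [ht.1, min_le_left ε δ]
      · linarith [ht.2, min_le_left ε δ]
    have ht2 : t ∈ Metric.ball (0 : ℝ) δ := by
      rw [Real.ball_eq_Ioo]
      constructor
      · linarith [ht.1, min_le_right ε δ]
      · linarith [ht.2, min_le_right ε δ]
    exact (hasMFDerivAt_chartAt_symm ((hα2 t (Ioo_subset_Icc_self ht1)).hasDerivAt
      (Icc_mem_nhds ht1.1 ht1.2)) (hpq hz1 (hq ht2))).hasMFDerivWithinAt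

end IntegralCurves

/-! ### Integral curves on complete Riemannian manifolds -/

section Completeness

open VectorField Set Manifold

variable {E : Type*} [NormedAddCommGroup E] [NormedSpace ℝ E] [FiniteDimensional ℝ E]
  {M : Type*} [EMetricSpace M] [ChartedSpace E M] [IsManifold 𝓘(ℝ, E) ∞ M]
  [Bundle.RiemannianBundle (fun x : M => TangentSpace 𝓘(ℝ, E) x)]
  [IsContMDiffRiemannianBundle 𝓘(ℝ, E) ∞ E (fun x : M => TangentSpace 𝓘(ℝ, E) x)]
  [IsRiemannianManifold 𝓘(ℝ, E) M]
  {X : Π x : M, TangentSpace 𝓘(ℝ, E) x}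

/-- Integral curves of a vector field of length at most one are `1`-Lipschitz. -/
theorem IsMIntegralCurveOn.edist_le (hX : ∀ x, SmoothFieldAt X x) (hX1 : ∀ x, ‖X x‖ ≤ 1)
    {γ : ℝ → M} {a b : ℝ} (hγ : IsMIntegralCurveOn γ X (Ioo a b)) {s t : ℝ} (hs : s ∈ Ioo a b)
    (ht : t ∈ Ioo a b) : edist (γ s) (γ t) ≤ edist s t := by
  wlog hst : s ≤ t generalizing s t
  · rw [edist_comm, edist_comm s]
    exact this ht hs (le_of_not_ge hst)
  have hsub : Icc s t ⊆ Ioo a b := fun r hr => ⟨hs.1.trans_le hr.1, hr.2.trans_lt ht.2⟩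
  rw [IsRiemannianManifold.out (I := 𝓘(ℝ, E)) (γ s) (γ t)]
  refine (riemannianEDist_le_pathELength
    (((hγ.contMDiffOn hX isOpen_Ioo).mono hsub).of_le (by simp)) rfl rfl hst).trans ?_
  rw [pathELength_eq_lintegral_mfderiv_Icc]
  have h1 : ∀ r ∈ Icc s t, ‖mfderiv 𝓘(ℝ, ℝ) 𝓘(ℝ, E) γ r (1 : ℝ)‖ₑ ≤ 1 := by
    intro r hr
    have h2 := (hγ r (hsub hr)).hasMFDerivAt (isOpen_Ioo.mem_nhds (hsub hr))
    have h3 : mfderiv 𝓘(ℝ, ℝ) 𝓘(ℝ, E) γ r (1 : ℝ) = X (γ r) := by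
      rw [h2.mfderiv]
      exact one_smul ℝ _
    rw [h3, ← ofReal_norm, ← ENNReal.ofReal_one]
    exact ENNReal.ofReal_le_ofReal (hX1 _)
  refine (MeasureTheory.setLIntegral_mono measurable_const h1).trans ?_
  rw [MeasureTheory.setLIntegral_const, one_mul, Real.volume_Icc, edist_comm, edist_dist,
    Real.dist_eq, abs_of_nonneg (sub_nonneg.2 hst)]

/-- On a complete Riemannian manifold, the integral curves of a smooth vector field of length at
most one exist for all positive times. -/
theorem exists_isMIntegralCurveOn_of_complete [CompleteSpace M] (hX : ∀ x, SmoothFieldAt X x)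
    (hX1 : ∀ x, ‖X x‖ ≤ 1) (x : M) :
    ∃ δ > (0 : ℝ), ∀ b, ∃ γ : ℝ → M, γ 0 = x ∧ IsMIntegralCurveOn γ X (Ioo (-δ) b) := by
  have hX' : ContMDiff 𝓘(ℝ, E) (𝓘(ℝ, E).prod 𝓘(ℝ, E)) 1 (T% X) := fun y => (hX y).of_le (by simp)
  obtain ⟨δ, hδ, h0⟩ := exists_uniform_isMIntegralCurveOn hX x
  refine ⟨δ, hδ, ?_⟩
  set S : Set ℝ := {b | ∃ γ : ℝ → M, γ 0 = x ∧ IsMIntegralCurveOn γ X (Ioo (-δ) b)} with hS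
  have hmono : ∀ b ∈ S, ∀ b' ≤ b, b' ∈ S := fun b ⟨γ, h1, h2⟩ b' hb' =>
    ⟨γ, h1, h2.mono (Ioo_subset_Ioo_right hb')⟩
  have hδS : δ ∈ S := h0.self_of_nhds
  by_cases hbdd : BddAbove S
  swap
  · intro b
    obtain ⟨b', hb', h⟩ := not_bddAbove_iff.1 hbdd b
    exact hmono b' hb' b h.le
  exfalso
  set A := sSup S with hA
  have hδA : δ ≤ A := le_csSup hbdd hδS
  have hlt : ∀ b < A, b ∈ S := fun b hb => by
    obtain ⟨b', hb', h⟩ := exists_lt_of_lt_csSup ⟨δ, hδS⟩ hb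
    exact hmono b' hb' b h.le
  -- The curves on the intervals `(-δ, b)` with `b < A` fit together to a curve on `(-δ, A)`.
  have hsel : ∀ b < A, ∃ γ : ℝ → M, γ 0 = x ∧ IsMIntegralCurveOn γ X (Ioo (-δ) (max b (δ / 2))) :=
    fun b hb => hlt _ (max_lt hb (by linarith))
  have : Nonempty M := ⟨x⟩
  choose! c hc0 hc using hsel
  have hagree : ∀ b < A, ∀ b' < A, ∀ t ∈ Ioo (-δ) (max b (δ / 2)),
      t ∈ Ioo (-δ) (max b' (δ / 2)) → c b t = c b' t := by
    intro b hb b' hb' t ht ht'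
    exact isMIntegralCurveOn_Ioo_eqOn_of_contMDiff_boundaryless (t₀ := 0) (a := -δ)
      (b := min (max b (δ / 2)) (max b' (δ / 2)))
      ⟨by linarith, lt_min (lt_max_of_lt_right (by linarith)) (lt_max_of_lt_right (by linarith))⟩
      hX'
      ((hc b hb).mono (Ioo_subset_Ioo_right (min_le_left _ _)))
      ((hc b' hb').mono (Ioo_subset_Ioo_right (min_le_right _ _)))
      (by rw [hc0 b hb, hc0 b' hb']) ⟨ht.1, lt_min ht.2 ht'.2⟩
  -- At time `t` any curve reaching beyond `t` may be used.
  set Γ : ℝ → M := fun t => c ((t + A) / 2) t with hΓ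
  have hΓeq : ∀ b < A, EqOn Γ (c b) (Ioo (-δ) (max b (δ / 2))) := fun b hb t ht => by
    have htA : t < A := ht.2.trans (max_lt hb (by linarith))
    exact hagree _ (by linarith) _ hb t ⟨ht.1, lt_max_of_lt_left (by linarith)⟩ ht
  have hΓ0 : Γ 0 = x := hc0 _ (by linarith)
  have hΓc : IsMIntegralCurveOn Γ X (Ioo (-δ) A) := by
    intro t ht
    have hb : (t + A) / 2 < A := by linarith [ht.2]
    have ht' : t ∈ Ioo (-δ) (max ((t + A) / 2) (δ / 2)) :=
      ⟨ht.1, lt_max_of_lt_left (by linarith [ht.2])⟩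
    have h1 := (hc _ hb t ht').hasMFDerivAt (isOpen_Ioo.mem_nhds ht')
    have h2 := h1.congr_of_eventuallyEq
      (Filter.eventuallyEq_of_mem (isOpen_Ioo.mem_nhds ht') (hΓeq _ hb))
    exact h2.hasMFDerivWithinAt
  -- This curve is Lipschitz, so it has a limit at `A`.
  have hcau : Cauchy (Filter.map Γ (𝓝[<] A)) := by
    refine EMetric.cauchy_iff.2 ⟨Filter.map_neBot.ne, fun ε hε => ?_⟩
    obtain ⟨s, hs, hsε⟩ := (EMetric.cauchy_iff.1 (cauchy_nhds.mono' inferInstance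
      (nhdsWithin_le_nhds (a := A) (s := Iio A)))).2 ε hε
    refine ⟨Γ '' (s ∩ Ioo (-δ) A), Filter.image_mem_map (Filter.inter_mem hs
      (Ioo_mem_nhdsLT (by linarith))), ?_⟩
    rintro _ ⟨r, hr, rfl⟩ _ ⟨r', hr', rfl⟩
    exact (hΓc.edist_le hX hX1 hr.2 hr'.2).trans_lt (hsε r hr.1 r' hr'.1)
  obtain ⟨y, hy⟩ := CompleteSpace.complete hcau
  obtain ⟨ε, hε, h1⟩ := exists_uniform_isMIntegralCurveOn hX y
  have h2 : ∀ᶠ t in 𝓝[<] A, t ∈ Ioo (max (A - ε) 0) A ∧ ∃ γ : ℝ → M, γ 0 = Γ t ∧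
      IsMIntegralCurveOn γ X (Ioo (-ε) ε) :=
    Filter.Eventually.and (Ioo_mem_nhdsLT (max_lt (by linarith) (by linarith))) (hy h1)
  obtain ⟨t, ht, γ, hγ0, hγ⟩ := h2.exists
  have ht0 : 0 < t := (le_max_right _ _).trans_lt ht.1
  have htε : A - ε < t := (le_max_left _ _).trans_lt ht.1
  -- Continue the curve past `A`, starting from a time close to `A`.
  have hγ' : IsMIntegralCurveOn (γ ∘ (· - t)) X (Ioo (t - ε) (t + ε)) := by
    refine (isMIntegralCurveOn_comp_sub.2 hγ).mono fun r hr => ?_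
    exact ⟨by linarith [hr.1], by linarith [hr.2]⟩
  have h3 := isMIntegralCurveOn_piecewise (t₀ := t) hX' hΓc hγ'
    ⟨⟨by linarith, ht.2⟩, by linarith, by linarith⟩ (by simp [hγ0])
  have h4 : t + ε ∈ S := ⟨_, by
      have h0 : (0 : ℝ) ∈ Ioo (-δ) A := ⟨by linarith, by linarith⟩
      rw [piecewise_eq_of_mem _ _ _ h0, hΓ0],
    h3.mono (Ioo_subset_Ioo_union_Ioo le_rfl (by linarith [ht.2]) le_rfl)⟩
  linarith [le_csSup hbdd h4]

end Completeness

/-! ### Curves in leaves -/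

section Leaves

open Set

variable {E : Type*} [NormedAddCommGroup E] [NormedSpace ℝ E] [FiniteDimensional ℝ E]
  {M : Type*} [TopologicalSpace M] [ChartedSpace E M]
  {k q : ℕ}

theorem mfderiv_comp_real {γ : ℝ → M} {f : ℝ → ℝ} {t : ℝ}
    (hγ : MDifferentiableAt 𝓘(ℝ, ℝ) 𝓘(ℝ, E) γ (f t)) (hf : DifferentiableAt ℝ f t) :
    mfderiv 𝓘(ℝ, ℝ) 𝓘(ℝ, E) (γ ∘ f) t (1 : ℝ)
      = deriv f t • mfderiv 𝓘(ℝ, ℝ) 𝓘(ℝ, E) γ (f t) (1 : ℝ) := by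
  rw [(hγ.hasMFDerivAt.comp t (hasMFDerivAt_iff_hasFDerivAt.2 hf.hasDerivAt.hasFDerivAt)).mfderiv]
  refine Eq.trans ?_ (map_smul (mfderiv 𝓘(ℝ, ℝ) 𝓘(ℝ, E) γ (f t)) (deriv f t) (1 : ℝ))
  exact congrArg (mfderiv 𝓘(ℝ, ℝ) 𝓘(ℝ, E) γ (f t))
    (show (1 : ℝ) • deriv f t = deriv f t • (1 : ℝ) by simp)

/-- The chain rule for a function along a curve. -/
theorem HasMFDerivAt.hasDerivAt_comp {γ : ℝ → M} {t : ℝ} {v : TangentSpace 𝓘(ℝ, E) (γ t)}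
    (hγ : HasMFDerivAt 𝓘(ℝ, ℝ) 𝓘(ℝ, E) γ t ((1 : ℝ →L[ℝ] ℝ).smulRight v)) {f : M → ℝ}
    (hf : MDiffAt f (γ t)) : HasDerivAt (f ∘ γ) (mvfderiv 𝓘(ℝ, E) f (γ t) v) t := by
  rw [hasDerivAt_iff_hasFDerivAt]
  refine (hasMFDerivAt_iff_hasFDerivAt.1 (hf.hasMFDerivAt.comp t hγ)).congr_fderiv
    (ContinuousLinearMap.ext_ring ?_)
  refine Eq.trans ?_ (one_smul ℝ (mvfderiv 𝓘(ℝ, E) f (γ t) v)).symm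
  exact congrArg (mfderiv 𝓘(ℝ, E) 𝓘(ℝ, ℝ) f (γ t)) (one_smul ℝ v)

namespace Foliation

variable {F : Foliation E M k q} {x y z : M}

theorem mem_leaf_self (F : Foliation E M k q) (x : M) : x ∈ F.leaf x := by
  refine ⟨fun _ => x, contMDiff_const, fun t => ?_, rfl, rfl⟩
  rw [mfderiv_const]
  exact Submodule.zero_mem _

/-- Reparametrizing a curve tangent to a foliation keeps it tangent. The curve need only be defined
on an open set containing the values of the parameter change. -/
theorem comp_tangent {γ : ℝ → M} {s : Set ℝ} (hs : IsOpen s)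
    (hγ : ContMDiffOn 𝓘(ℝ, ℝ) 𝓘(ℝ, E) ∞ γ s)
    (hγF : ∀ t ∈ s, mfderiv 𝓘(ℝ, ℝ) 𝓘(ℝ, E) γ t (1 : ℝ) ∈ F.tangent (γ t)) {f : ℝ → ℝ}
    (hf : ContDiff ℝ ∞ f) (hfs : ∀ t, f t ∈ s) :
    ContMDiff 𝓘(ℝ, ℝ) 𝓘(ℝ, E) ∞ (γ ∘ f) ∧
      ∀ t, mfderiv 𝓘(ℝ, ℝ) 𝓘(ℝ, E) (γ ∘ f) t (1 : ℝ) ∈ F.tangent ((γ ∘ f) t) := by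
  have h1 : ∀ t, ContMDiffAt 𝓘(ℝ, ℝ) 𝓘(ℝ, E) ∞ γ (f t) := fun t =>
    (hγ _ (hfs t)).contMDiffAt (hs.mem_nhds (hfs t))
  refine ⟨fun t => (h1 t).comp t hf.contMDiff.contMDiffAt, fun t => ?_⟩
  rw [mfderiv_comp_real ((h1 t).mdifferentiableAt (by simp)) (hf.differentiable (by simp) t)]
  exact Submodule.smul_mem _ _ (hγF _ (hfs t))

/-- The points of a smooth curve tangent to a foliation lie in one leaf. -/
theorem mem_leaf_of_curve {γ : ℝ → M} {s : Set ℝ} (hs : IsOpen s)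
    (hγ : ContMDiffOn 𝓘(ℝ, ℝ) 𝓘(ℝ, E) ∞ γ s)
    (hγF : ∀ t ∈ s, mfderiv 𝓘(ℝ, ℝ) 𝓘(ℝ, E) γ t (1 : ℝ) ∈ F.tangent (γ t)) (hx : γ 0 = x) {τ : ℝ}
    (hτ : uIcc 0 τ ⊆ s) : γ τ ∈ F.leaf x := by
  obtain ⟨h1, h2⟩ := comp_tangent hs hγ hγF (f := fun r => Real.smoothTransition r * τ)
    (Real.smoothTransition.contDiff.mul contDiff_const) fun t => hτ (by
      have h0 := Real.smoothTransition.nonneg t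
      have h1 := Real.smoothTransition.le_one t
      rw [mem_uIcc]
      rcases le_total 0 τ with h | h
      · left; constructor <;> nlinarith
      · right; constructor <;> nlinarith)
  exact ⟨_, h1, h2, by simp [hx], by simp⟩

theorem leaf_trans (hy : y ∈ F.leaf x) (hz : z ∈ F.leaf y) : z ∈ F.leaf x := by
  obtain ⟨γ₁, h1, h1F, h10, h11⟩ := hy
  obtain ⟨γ₂, h2, h2F, h20, h21⟩ := hz
  -- Both curves are reparametrized so that they rest at `y` on `(1/4, 3/4)`.
  obtain ⟨g1, g1F⟩ := comp_tangent isOpen_univ h1.contMDiffOn (fun t _ => h1F t)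
    (f := fun r => Real.smoothTransition (4 * r))
    (Real.smoothTransition.contDiff.comp (contDiff_const.mul contDiff_id)) fun _ => mem_univ _
  obtain ⟨g2, g2F⟩ := comp_tangent isOpen_univ h2.contMDiffOn (fun t _ => h2F t)
    (f := fun r => Real.smoothTransition (4 * r - 3))
    (Real.smoothTransition.contDiff.comp ((contDiff_const.mul contDiff_id).sub contDiff_const))
    fun _ => mem_univ _
  set β₁ : ℝ → M := γ₁ ∘ fun r => Real.smoothTransition (4 * r)
  set β₂ : ℝ → M := γ₂ ∘ fun r => Real.smoothTransition (4 * r - 3)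
  have hβ₁ : ∀ t, 1 / 4 ≤ t → β₁ t = y := fun t ht => by
    simp only [β₁, Function.comp_apply]
    rw [Real.smoothTransition.one_of_one_le (by linarith), h11]
  have hβ₂ : ∀ t, t ≤ 3 / 4 → β₂ t = y := fun t ht => by
    simp only [β₂, Function.comp_apply]
    rw [Real.smoothTransition.zero_of_nonpos (by linarith), h20]
  set β : ℝ → M := fun t => if t < 1 / 2 then β₁ t else β₂ t
  have hb1 : ∀ t < 1 / 2, β =ᶠ[𝓝 t] β₁ := fun t ht => by
    filter_upwards [Iio_mem_nhds ht] with r hr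
    exact if_pos hr
  have hb2 : ∀ t, 1 / 4 < t → β =ᶠ[𝓝 t] β₂ := fun t ht => by
    filter_upwards [Ioi_mem_nhds ht] with r hr
    by_cases h : r < 1 / 2
    · rw [show β r = β₁ r from if_pos h, hβ₁ r (le_of_lt hr), hβ₂ r (by linarith)]
    · exact if_neg h
  refine ⟨β, fun t => ?_, fun t => ?_, ?_, ?_⟩
  · rcases lt_or_ge t (1 / 2) with ht | ht
    · exact (g1 t).congr_of_eventuallyEq (hb1 t ht)
    · exact (g2 t).congr_of_eventuallyEq (hb2 t (by linarith))
  · rcases lt_or_ge t (1 / 2) with ht | ht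
    · rw [(hb1 t ht).mfderiv_eq, (hb1 t ht).self_of_nhds]
      exact g1F t
    · rw [(hb2 t (by linarith)).mfderiv_eq, (hb2 t (by linarith)).self_of_nhds]
      exact g2F t
  · rw [(hb1 0 (by norm_num)).self_of_nhds]
    simp [β₁, h10]
  · rw [(hb2 1 (by norm_num)).self_of_nhds]
    norm_num [β₂, h21]

/-- The image of a segment under a smooth map lies in one leaf if the direction of the segment is
mapped to tangent vectors of the leaves. -/
theorem mem_leaf_of_segment {P : Type*} [NormedAddCommGroup P] [NormedSpace ℝ P] {ψ : P → M}
    {U : Set P} (hU : IsOpen U) (hψ : ContMDiffOn 𝓘(ℝ, P) 𝓘(ℝ, E) ∞ ψ U) {z w : P} {τ : ℝ}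
    (hw : ∀ t : ℝ, z + t • w ∈ U →
      mfderiv 𝓘(ℝ, P) 𝓘(ℝ, E) ψ (z + t • w) w ∈ F.tangent (ψ (z + t • w)))
    (hseg : ∀ t ∈ uIcc 0 τ, z + t • w ∈ U) : ψ (z + τ • w) ∈ F.leaf (ψ z) := by
  have hβ : ContDiff ℝ ∞ fun t : ℝ => z + t • w :=
    contDiff_const.add (contDiff_id.smul contDiff_const)
  refine mem_leaf_of_curve (γ := ψ ∘ fun t : ℝ => z + t • w)
    (hU.preimage hβ.continuous) (hψ.comp hβ.contMDiff.contMDiffOn fun _ h => h) (fun t ht => ?_)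
    (by simp) hseg
  have h1 : MDifferentiableAt 𝓘(ℝ, P) 𝓘(ℝ, E) ψ (z + t • w) :=
    ((hψ _ ht).contMDiffAt (hU.mem_nhds ht)).mdifferentiableAt (by simp)
  have h2 : HasDerivAt (fun t : ℝ => z + t • w) w t := by
    simpa using ((hasDerivAt_id t).smul_const w).const_add z
  rw [(h1.hasMFDerivAt.comp t (hasMFDerivAt_iff_hasFDerivAt.2 h2.hasFDerivAt)).mfderiv]
  have h3 : mfderiv 𝓘(ℝ, P) 𝓘(ℝ, E) ψ (z + t • w) ((1 : ℝ) • w)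
      ∈ F.tangent (ψ (z + t • w)) := by
    rw [one_smul]
    exact hw t ht
  exact h3

variable [IsManifold 𝓘(ℝ, E) ∞ M]

/-- A differentiable function that vanishes on a leaf has vanishing derivative along the leaf. -/
theorem mvfderiv_eq_zero_of_leaf {f : M → ℝ} (hf : MDiffAt f x) (hf0 : ∀ y ∈ F.leaf x, f y = 0)
    {v : TangentSpace 𝓘(ℝ, E) x} (hv : v ∈ F.tangent x) : mvfderiv 𝓘(ℝ, E) f x v = 0 := by
  obtain ⟨φ, hx, h1, h2, h3⟩ := F.exists_chart x
  set P := EuclideanSpace ℝ (Fin k) × EuclideanSpace ℝ (Fin q)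
  have hφ : φ.MDifferentiable 𝓘(ℝ, E) 𝓘(ℝ, P) :=
    ⟨h1.mdifferentiableOn (by simp), h2.mdifferentiableOn (by simp)⟩
  have hz : φ x ∈ φ.target := φ.map_source hx
  have hzx : φ.symm (φ x) = x := φ.left_inv hx
  obtain ⟨w, hw⟩ : ∃ w : P, w = mfderiv 𝓘(ℝ, E) 𝓘(ℝ, P) φ x v := ⟨_, rfl⟩
  have hw2 : w.2 = 0 := by rw [hw]; exact (h3 x hx v).1 hv
  have hg : MDifferentiableAt 𝓘(ℝ, P) 𝓘(ℝ, ℝ) (f ∘ φ.symm) (φ x) :=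
    MDifferentiableAt.comp (φ x) (hzx.symm ▸ hf) (hφ.mdifferentiableAt_symm hz)
  have hgd : DifferentiableAt ℝ (f ∘ φ.symm) (φ x) := mdifferentiableAt_iff_differentiableAt.1 hg
  have h4 : mvfderiv 𝓘(ℝ, E) f x v = fderiv ℝ (f ∘ φ.symm) (φ x) w := by
    have h5 : f =ᶠ[𝓝 x] (f ∘ φ.symm) ∘ φ := by
      filter_upwards [φ.open_source.mem_nhds hx] with y hy
      simp [φ.left_inv hy]
    rw [h5.mvfderiv_eq, mvfderiv_comp x hg (hφ.mdifferentiableAt hx), hw, ← mfderiv_eq_fderiv]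
    rfl
  have hline : HasDerivAt (fun t : ℝ => φ x + t • w) w 0 := by
    simpa using ((hasDerivAt_id (0 : ℝ)).smul_const w).const_add (φ x)
  have h6 : HasDerivAt ((f ∘ φ.symm) ∘ fun t : ℝ => φ x + t • w)
      (fderiv ℝ (f ∘ φ.symm) (φ x) w) 0 := by
    refine HasFDerivAt.comp_hasDerivAt (0 : ℝ) ?_ hline
    simpa using hgd.hasFDerivAt
  have h7 : ∀ᶠ t : ℝ in 𝓝 0, ((f ∘ φ.symm) ∘ fun t : ℝ => φ x + t • w) t = 0 := by
    have h8 : ∀ᶠ t : ℝ in 𝓝 0, φ x + t • w ∈ φ.target :=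
      hline.continuousAt.eventually (φ.open_target.mem_nhds (by simpa using hz))
    obtain ⟨ε, hε, h8⟩ := Metric.nhds_basis_ball.eventually_iff.1 h8
    filter_upwards [Metric.ball_mem_nhds (0 : ℝ) hε] with t ht
    refine hf0 _ ?_
    have h9 := mem_leaf_of_segment (F := F) φ.open_target h2 (z := φ x) (w := w) (τ := t)
      (fun r hr => ?_) (fun r hr => h8 ?_)
    · rwa [hzx] at h9
    · refine (h3 _ (φ.map_target hr) _).2 ?_
      have := DFunLike.congr_fun (hφ.comp_symm_deriv hr) w
      exact (congrArg Prod.snd this).trans hw2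
    · rw [Real.ball_eq_Ioo] at ht ⊢
      exact (ordConnected_Ioo.uIcc_subset ⟨by linarith, by linarith⟩ ht) hr
  rw [h4, ← h6.deriv, Filter.EventuallyEq.deriv_eq (f := fun _ => (0 : ℝ)) h7, deriv_const]

variable [Bundle.RiemannianBundle (fun x : M => TangentSpace 𝓘(ℝ, E) x)]
  [IsContMDiffRiemannianBundle 𝓘(ℝ, E) ∞ E (fun x : M => TangentSpace 𝓘(ℝ, E) x)]

/-- A field that vanishes on a leaf has vanishing covariant derivative along the leaf. -/
theorem leviCivita_eq_zero_of_leaf {Z : Π x : M, TangentSpace 𝓘(ℝ, E) x} (hZ : SmoothFieldAt Z x)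
    (hZ0 : ∀ y ∈ F.leaf x, Z y = 0) {v : TangentSpace 𝓘(ℝ, E) x} (hv : v ∈ F.tangent x) :
    leviCivita Z x v = 0 := by
  refine inner_self_eq_zero (𝕜 := ℝ).1 ?_
  set W : Π x : M, TangentSpace 𝓘(ℝ, E) x := FiberBundle.extend E (leviCivita Z x v)
  have hW : SmoothFieldAt W x := smoothFieldAt_extend _
  have hWx : W x = leviCivita Z x v := FiberBundle.extend_apply_self E _
  have h1 := mvfderiv_inner hZ.mdifferentiableAt hW.mdifferentiableAt v
  rw [F.mvfderiv_eq_zero_of_leaf (mdifferentiableAt_inner hZ.mdifferentiableAt hW.mdifferentiableAt)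
    (fun y hy => by rw [hZ0 y hy, inner_zero_left]) hv, hZ0 x (F.mem_leaf_self x), inner_zero_left,
    add_zero, hWx] at h1
  exact h1.symm

end Foliation

end Leaves

/-! ### The Riccati inequality and total geodesy -/

section Riccati

open Set

/-- A positive solution of the Riccati inequality `2 g² ≤ k √(1 + g) g'` blows up in finite time,
because `(√g)⁻¹` decreases at least at a constant rate. -/
theorem riccati_time_bound {g g' : ℝ → ℝ} {k b : ℝ} (hk : 0 < k)
    (hg : ∀ t ∈ Ico 0 b, HasDerivAt g (g' t) t) (hg_nonneg : ∀ t, 0 ≤ g t) (hg0 : 0 < g 0)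
    (hineq : ∀ t ∈ Ico 0 b, 2 * g t ^ 2 ≤ k * √(1 + g t) * g' t) :
    b ≤ k * √(1 + (g 0)⁻¹) * (√(g 0))⁻¹ := by
  by_contra! hb
  set K := √(1 + (g 0)⁻¹) with hK
  have hK0 : 0 < K := Real.sqrt_pos.2 (by positivity)
  set T := k * K * (√(g 0))⁻¹ with hT
  have hT0 : 0 ≤ T := by positivity
  have hsub : Icc 0 T ⊆ Ico 0 b := fun t ht => ⟨ht.1, ht.2.trans_lt hb⟩
  have hs : ∀ t, 0 < √(1 + g t) := fun t => Real.sqrt_pos.2 (by linarith [hg_nonneg t])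
  have hg' : ∀ t ∈ Ico 0 b, 0 ≤ g' t := fun t ht => by
    have h1 : 0 ≤ k * √(1 + g t) * g' t := le_trans (by positivity) (hineq t ht)
    exact nonneg_of_mul_nonneg_right h1 (mul_pos hk (hs t))
  have hmono : MonotoneOn g (Icc 0 T) := by
    refine monotoneOn_of_hasDerivWithinAt_nonneg (convex_Icc _ _)
      (fun t ht => (hg t (hsub ht)).continuousAt.continuousWithinAt)
      (fun t ht => (hg t (hsub (interior_subset ht))).hasDerivWithinAt)
      fun t ht => hg' t (hsub (interior_subset ht))
  have hge : ∀ t ∈ Icc 0 T, g 0 ≤ g t := fun t ht => hmono ⟨le_rfl, hT0⟩ ht ht.1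
  have hder : ∀ t ∈ Icc 0 T, HasDerivAt (fun t => (√(g t))⁻¹ + t / (k * K))
      (-(g' t / (2 * √(g t))) / √(g t) ^ 2 + 1 / (k * K)) t := fun t ht => by
    have hpos : 0 < g t := hg0.trans_le (hge t ht)
    exact (((hg t (hsub ht)).sqrt hpos.ne').inv (Real.sqrt_pos.2 hpos).ne').add
      ((hasDerivAt_id t).div_const _)
  have hanti : AntitoneOn (fun t => (√(g t))⁻¹ + t / (k * K)) (Icc 0 T) := by
    refine antitoneOn_of_hasDerivWithinAt_nonpos (convex_Icc _ _)
      (fun t ht => (hder t ht).continuousAt.continuousWithinAt)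
      (fun t ht => (hder t (interior_subset ht)).hasDerivWithinAt) fun t ht => ?_
    have ht := interior_subset ht
    have hpos : 0 < g t := hg0.trans_le (hge t ht)
    have hsq : 0 < √(g t) := Real.sqrt_pos.2 hpos
    have hss : √(g t) ^ 2 = g t := Real.sq_sqrt hpos.le
    have h1 : √(1 + g t) ≤ K * √(g t) := by
      rw [hK, ← Real.sqrt_mul (by positivity)]
      refine Real.sqrt_le_sqrt ?_
      have : 1 ≤ (g 0)⁻¹ * g t := by
        rw [inv_mul_eq_div, le_div_iff₀ hg0]
        linarith [hge t ht]
      linarith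
    have h2 : 2 * g t ^ 2 ≤ k * (K * √(g t)) * g' t :=
      (hineq t (hsub ht)).trans (mul_le_mul_of_nonneg_right
        (mul_le_mul_of_nonneg_left h1 hk.le) (hg' t (hsub ht)))
    have h3 : 1 / (k * K) ≤ g' t / (2 * √(g t)) / √(g t) ^ 2 := by
      rw [div_div, div_le_div_iff₀ (by positivity) (by positivity), hss, one_mul]
      refine le_of_mul_le_mul_left ?_ hsq
      calc √(g t) * (2 * √(g t) * g t) = 2 * g t * √(g t) ^ 2 := by ring
        _ = 2 * g t ^ 2 := by rw [hss]; ring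
        _ ≤ k * (K * √(g t)) * g' t := h2
        _ = √(g t) * (g' t * (k * K)) := by ring
    rw [neg_div]
    linarith
  have h1 := hanti ⟨le_rfl, hT0⟩ ⟨hT0, le_rfl⟩ hT0
  have h2 : T / (k * K) = (√(g 0))⁻¹ := by rw [hT]; field_simp
  have h3 : 0 < (√(g T))⁻¹ :=
    inv_pos.2 (Real.sqrt_pos.2 (hg0.trans_le (hge T ⟨hT0, le_rfl⟩)))
  simp only [h2, zero_div] at h1
  linarith

variable {E : Type*} [NormedAddCommGroup E] [NormedSpace ℝ E] [FiniteDimensional ℝ E]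
  {M : Type*} [EMetricSpace M] [ChartedSpace E M] [IsManifold 𝓘(ℝ, E) ∞ M]
  [Bundle.RiemannianBundle (fun x : M => TangentSpace 𝓘(ℝ, E) x)]
  [IsContMDiffRiemannianBundle 𝓘(ℝ, E) ∞ E (fun x : M => TangentSpace 𝓘(ℝ, E) x)]
  {k q : ℕ} {x : M}

/-- Rescaling a smooth field `Z` to `Z / √(1 + |Z|²)`, a field of length at most one with the same
zeros, keeps it smooth. -/
theorem SmoothFieldAt.inv_sqrt_smul {Z : Π x : M, TangentSpace 𝓘(ℝ, E) x}
    (hZ : SmoothFieldAt Z x) :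
    SmoothFieldAt (fun y => (√(1 + inner ℝ (Z y) (Z y)))⁻¹ • Z y) x := by
  refine SmoothFieldAt.smul ?_ hZ
  have h1 : 0 < 1 + (inner ℝ (Z x) (Z x) : ℝ) := by
    linarith [real_inner_self_nonneg (x := Z x)]
  have h2 : ContDiffAt ℝ ∞ (fun s : ℝ => (√(1 + s))⁻¹) (inner ℝ (Z x) (Z x)) :=
    ((contDiffAt_const.add contDiffAt_id).sqrt h1.ne').inv (Real.sqrt_pos.2 h1).ne'
  exact ContMDiffAt.comp (g := fun s : ℝ => (√(1 + s))⁻¹) x h2.contMDiffAt (hZ.contMDiffAt_inner hZ)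

theorem norm_inv_sqrt_smul_le {V : Type*} [NormedAddCommGroup V] [InnerProductSpace ℝ V] (v : V) :
    ‖(√(1 + inner ℝ v v))⁻¹ • v‖ ≤ 1 := by
  have h1 : (0 : ℝ) < 1 + inner ℝ v v := by linarith [real_inner_self_nonneg (x := v)]
  rw [norm_smul, norm_inv, Real.norm_of_nonneg (Real.sqrt_nonneg _), inv_mul_eq_div,
    div_le_one (Real.sqrt_pos.2 h1)]
  refine Real.le_sqrt_of_sq_le ?_
  rw [real_inner_self_eq_norm_sq]
  linarith

namespace Foliation

variable {F : Foliation E M k q} {G : Foliation E M q k}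

/-- On a complete manifold, the mean curvature vector of `F` vanishes along the leaves of `G` on
which the divergence of the mean curvature vector of `G` is at most `k c`: otherwise its norm would
blow up in finite time along its (rescaled) integral curves. -/
theorem totalMeanCurvature_eq_zero [IsRiemannianManifold 𝓘(ℝ, E) M] [CompleteSpace M] {c : ℝ}
    (hcurv : HasConstantCurvature E M c) (horth : ∀ x : M, G.tangent x = (F.tangent x)ᗮ)
    (hG : G.IsTotallyUmbilical) (hk : 0 < k)
    (hdiv : ∀ y ∈ G.leaf x, F.divergence G.meanCurvature y ≤ k * c) :
    F.totalMeanCurvature x = 0 := by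
  set Z := F.totalMeanCurvature with hZdef
  have hZ : ∀ y, SmoothFieldAt Z y := F.smooth_totalMeanCurvature
  have hZd := fun y => (hZ y).mdifferentiableAt
  set W : Π x : M, TangentSpace 𝓘(ℝ, E) x := fun y => (√(1 + inner ℝ (Z y) (Z y)))⁻¹ • Z y with hW
  have hWs : ∀ y, SmoothFieldAt W y := fun y => (hZ y).inv_sqrt_smul
  obtain ⟨δ, hδ, hflow⟩ := exists_isMIntegralCurveOn_of_complete hWs
    (fun y => norm_inv_sqrt_smul_le (Z y)) x
  by_contra hne
  set g : M → ℝ := fun y => inner ℝ (Z y) (Z y) with hgdef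
  have hpos : 0 < g x := by
    simp only [hgdef]
    rw [real_inner_self_eq_norm_sq]
    have := norm_pos_iff.2 hne
    positivity
  -- A time beyond the blow-up time of `g` along the integral curve.
  set b := k * √(1 + (g x)⁻¹) * (√(g x))⁻¹ + 1 with hb
  obtain ⟨γ, hγ0, hγ⟩ := hflow b
  have hmem : ∀ t ∈ Ico 0 b, t ∈ Ioo (-δ) b := fun t ht => ⟨by linarith [ht.1], ht.2⟩
  have hd : ∀ t ∈ Ioo (-δ) b, HasMFDerivAt 𝓘(ℝ, ℝ) 𝓘(ℝ, E) γ t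
      ((1 : ℝ →L[ℝ] ℝ).smulRight (W (γ t))) := fun t ht =>
    (hγ t ht).hasMFDerivAt (isOpen_Ioo.mem_nhds ht)
  have hleaf : ∀ t ∈ Ico 0 b, γ t ∈ G.leaf x := fun t ht =>
    G.mem_leaf_of_curve isOpen_Ioo (hγ.contMDiffOn hWs isOpen_Ioo) (fun r hr => by
      rw [(hd r hr).mfderiv]
      have h1 : (1 : ℝ) • W (γ r) ∈ G.tangent (γ r) := by
        rw [horth]
        exact Submodule.smul_mem _ _ (Submodule.smul_mem _ _ (F.totalMeanCurvature_mem _))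
      exact h1) hγ0
      (by
        rw [uIcc_of_le ht.1]
        exact fun r hr => ⟨by linarith [hr.1], hr.2.trans_lt ht.2⟩)
  have hg : ∀ t ∈ Ico 0 b, HasDerivAt (g ∘ γ) (mvfderiv 𝓘(ℝ, E) g (γ t) (W (γ t))) t := fun t ht =>
    (hd t (hmem t ht)).hasDerivAt_comp (mdifferentiableAt_inner (hZd _) (hZd _))
  have hgγ : (g ∘ γ) 0 = g x := congrArg g hγ0
  have h1 := riccati_time_bound (k := k) (Nat.cast_pos.2 hk) hg
    (fun t => real_inner_self_nonneg) (by rw [hgγ]; exact hpos)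
    fun t ht => by
      have h2 := riccati_totalMeanCurvature hcurv horth hG (hdiv _ (hleaf t ht))
      have h3 : 0 < √(1 + g (γ t)) := Real.sqrt_pos.2 (by
        linarith [real_inner_self_nonneg (x := Z (γ t))])
      have h4 : mvfderiv 𝓘(ℝ, E) g (γ t) (W (γ t))
          = 2 * ((√(1 + g (γ t)))⁻¹ * inner ℝ (Z (γ t)) (leviCivita Z (γ t) (Z (γ t)))) := by
        rw [mvfderiv_inner (hZd _) (hZd _), hW, leviCivita_smul_right (hZd _), real_inner_smul_left,
          real_inner_smul_right, real_inner_comm (Z (γ t)) (leviCivita Z (γ t) (Z (γ t)))]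
        simp only [hgdef]
        ring
      rw [h4]
      calc 2 * (g ∘ γ) t ^ 2 = 2 * ‖Z (γ t)‖ ^ 4 := by
            simp only [g, Function.comp_apply, real_inner_self_eq_norm_sq]; ring
        _ ≤ 2 * (k * inner ℝ (Z (γ t)) (leviCivita Z (γ t) (Z (γ t)))) := by linarith
        _ = _ := by
          simp only [Function.comp_apply]
          field_simp
  rw [hgγ] at h1
  linarith

/-- If the mean curvature vector of `G` has maximal length at `x`, and its divergence is at most
`k c` along the leaf of `G` through `x`, then the manifold is flat and both foliations are totally
geodesic. -/
theorem totallyGeodesic_of_divergence_le [IsRiemannianManifold 𝓘(ℝ, E) M] [CompleteSpace M]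
    {c : ℝ} (hc : 0 ≤ c)
    (hcurv : HasConstantCurvature E M c) (horth : ∀ x : M, G.tangent x = (F.tangent x)ᗮ)
    (hG : G.IsTotallyUmbilical) (hk : 0 < k) (hq : 0 < q)
    (hmax : ∀ y : M, ‖G.meanCurvature y‖ ≤ ‖G.meanCurvature x‖)
    (hdiv : ∀ y ∈ G.leaf x, F.divergence G.meanCurvature y ≤ k * c) :
    c = 0 ∧ F.IsTotallyGeodesic ∧ G.IsTotallyGeodesic := by
  -- On every leaf of `G` with the divergence bound, `Z = 0`, so the rigid case is attained.
  have hrig : ∀ y, (∀ z ∈ G.leaf y, F.divergence G.meanCurvature z ≤ k * c) →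
      (∀ u ∈ F.tangent y, ∀ v ∈ F.tangent y, F.secondFundamentalForm y u v = 0) ∧
        G.meanCurvature y = 0 ∧ F.divergence G.meanCurvature y = k * c := by
    intro y hy
    have hZ0 : ∀ z ∈ G.leaf y, F.totalMeanCurvature z = 0 := fun z hz =>
      totalMeanCurvature_eq_zero hcurv horth hG hk fun w hw => hy w (leaf_trans hz hw)
    obtain ⟨h1, h2⟩ := rigidity_of_parallel hcurv horth hG (hy y (G.mem_leaf_self y))
      fun v hv => leviCivita_eq_zero_of_leaf (F.smooth_totalMeanCurvature y) hZ0 hv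
    obtain ⟨e, he⟩ := G.exists_orthonormalFrame y
    refine ⟨h1, h2 (e ⟨0, hq⟩ y) (he.mem _).self_of_nhds fun h0 => ?_⟩
    have := he.orthonormal.self_of_nhds.1 ⟨0, hq⟩
    exact zero_ne_one ((norm_eq_zero.2 h0).symm.trans this)
  -- The maximum of `|h|` is zero, so the divergence bound holds on all leaves.
  have hh : ∀ y, G.meanCurvature y = 0 := fun y => by
    have := hmax y
    rw [(hrig x hdiv).2.1, norm_zero] at this
    exact norm_le_zero_iff.1 this
  have hdiv0 : ∀ y, F.divergence G.meanCurvature y = 0 := fun y => by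
    refine Finset.sum_eq_zero fun i _ => ?_
    rw [leviCivita_eq_zero_of_leaf (F := F) (G.smooth_meanCurvature y) (fun z _ => hh z)
      (Subtype.coe_prop _), inner_zero_right]
  have hk' : (0 : ℝ) < k := Nat.cast_pos.2 hk
  have hall := fun y => hrig y fun z _ => by
    rw [hdiv0]
    positivity
  refine ⟨?_, fun y u hu v hv => (hall y).1 u hu v hv, fun y u hu v hv => ?_⟩
  · have := (hall x).2.2
    rw [hdiv0] at this
    rcases mul_eq_zero.1 this.symm with h | h
    · exact absurd h hk'.ne'
    · exact h
  · rw [hG y u hu v hv, hh y, smul_zero]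

end Foliation

end Riccati

/-! ### Charts adapted to two complementary foliations -/

section ProductCharts

open Set

variable {E : Type*} [NormedAddCommGroup E] [NormedSpace ℝ E] [FiniteDimensional ℝ E]
  {M : Type*} [TopologicalSpace M] [ChartedSpace E M] [IsManifold 𝓘(ℝ, E) ∞ M] {k q : ℕ}

theorem mfderiv_clm_comp {P Q : Type*} [NormedAddCommGroup P] [NormedSpace ℝ P]
    [NormedAddCommGroup Q] [NormedSpace ℝ Q] (L : P →L[ℝ] Q) {g : M → P} {y : M}
    (hg : MDifferentiableAt 𝓘(ℝ, E) 𝓘(ℝ, P) g y) (v : TangentSpace 𝓘(ℝ, E) y) :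
    mfderiv 𝓘(ℝ, E) 𝓘(ℝ, Q) (L ∘ g) y v = L (mfderiv 𝓘(ℝ, E) 𝓘(ℝ, P) g y v) := by
  rw [((hasMFDerivAt_iff_hasFDerivAt.2 L.hasFDerivAt).comp y hg.hasMFDerivAt).mfderiv]
  rfl

/-- A smooth chart of two complementary foliations: the transverse coordinates of either foliation
serve as coordinates along the leaves of the other. -/
theorem Foliation.exists_product_chart (F : Foliation E M k q) (G : Foliation E M q k)
    (hFG : ∀ x, ∀ v ∈ F.tangent x, v ∈ G.tangent x → v = 0) (x : M) :
    ∃ (φ : OpenPartialHomeomorph M (EuclideanSpace ℝ (Fin k) × EuclideanSpace ℝ (Fin q)))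
      (A : Set (EuclideanSpace ℝ (Fin k))) (B : Set (EuclideanSpace ℝ (Fin q))),
      x ∈ φ.source ∧ IsOpen A ∧ IsOpen B ∧ Convex ℝ A ∧ Convex ℝ B ∧ φ.target = A ×ˢ B ∧
      ContMDiffOn 𝓘(ℝ, E) 𝓘(ℝ, EuclideanSpace ℝ (Fin k) × EuclideanSpace ℝ (Fin q)) ∞ φ φ.source ∧
      ContMDiffOn 𝓘(ℝ, EuclideanSpace ℝ (Fin k) × EuclideanSpace ℝ (Fin q)) 𝓘(ℝ, E) ∞
        φ.symm φ.target ∧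
      ∀ y ∈ φ.source, ∀ v : TangentSpace 𝓘(ℝ, E) y,
        (v ∈ F.tangent y ↔ (mfderiv 𝓘(ℝ, E)
          𝓘(ℝ, EuclideanSpace ℝ (Fin k) × EuclideanSpace ℝ (Fin q)) φ y v :
            EuclideanSpace ℝ (Fin k) × EuclideanSpace ℝ (Fin q)).2 = 0) ∧
        (v ∈ G.tangent y ↔ (mfderiv 𝓘(ℝ, E)
          𝓘(ℝ, EuclideanSpace ℝ (Fin k) × EuclideanSpace ℝ (Fin q)) φ y v :
            EuclideanSpace ℝ (Fin k) × EuclideanSpace ℝ (Fin q)).1 = 0) := by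
  obtain ⟨φ, hx, hφs, hφs', hφF⟩ := F.exists_chart x
  obtain ⟨ψ, hxψ, hψs, hψs', hψG⟩ := G.exists_chart x
  set Pk := EuclideanSpace ℝ (Fin k)
  set Pq := EuclideanSpace ℝ (Fin q)
  have hφ : φ.MDifferentiable 𝓘(ℝ, E) 𝓘(ℝ, Pk × Pq) :=
    ⟨hφs.mdifferentiableOn (by simp), hφs'.mdifferentiableOn (by simp)⟩
  -- The transverse coordinates of both charts.
  set Φ : M → Pk × Pq := fun y => ((ψ y).2, (φ y).2) with hΦ
  set U : Set M := φ.source ∩ ψ.source with hU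
  have hUo : IsOpen U := φ.open_source.inter ψ.open_source
  have hφat : ∀ y ∈ U, ContMDiffAt 𝓘(ℝ, E) 𝓘(ℝ, Pk × Pq) ∞ φ y := fun y hy =>
    (hφs y hy.1).contMDiffAt (φ.open_source.mem_nhds hy.1)
  have hψat : ∀ y ∈ U, ContMDiffAt 𝓘(ℝ, E) 𝓘(ℝ, Pq × Pk) ∞ ψ y := fun y hy =>
    (hψs y hy.2).contMDiffAt (ψ.open_source.mem_nhds hy.2)
  have hΦs : ∀ y ∈ U, ContMDiffAt 𝓘(ℝ, E) 𝓘(ℝ, Pk × Pq) ∞ Φ y := fun y hy =>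
    ((ContinuousLinearMap.snd ℝ Pq Pk).contDiff.contMDiff.contMDiffAt.comp y
      (hψat y hy)).prodMk_space
      ((ContinuousLinearMap.snd ℝ Pk Pq).contDiff.contMDiff.contMDiffAt.comp y (hφat y hy))
  have hΦd : ∀ y ∈ U, MDifferentiableAt 𝓘(ℝ, E) 𝓘(ℝ, Pk × Pq) Φ y := fun y hy =>
    (hΦs y hy).mdifferentiableAt (by simp)
  have hΦ1 : ∀ y ∈ U, ∀ v, v ∈ G.tangent y ↔
      (mfderiv 𝓘(ℝ, E) 𝓘(ℝ, Pk × Pq) Φ y v : Pk × Pq).1 = 0 := fun y hy v => by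
    rw [hψG y hy.2 v]
    have h1 := mfderiv_clm_comp (ContinuousLinearMap.fst ℝ Pk Pq) (hΦd y hy) v
    have h2 := mfderiv_clm_comp (ContinuousLinearMap.snd ℝ Pq Pk)
      ((hψat y hy).mdifferentiableAt (by simp)) v
    exact Eq.congr (h2.symm.trans h1) rfl
  have hΦ2 : ∀ y ∈ U, ∀ v, v ∈ F.tangent y ↔
      (mfderiv 𝓘(ℝ, E) 𝓘(ℝ, Pk × Pq) Φ y v : Pk × Pq).2 = 0 := fun y hy v => by
    rw [hφF y hy.1 v]
    have h1 := mfderiv_clm_comp (ContinuousLinearMap.snd ℝ Pk Pq) (hΦd y hy) v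
    have h2 := mfderiv_clm_comp (ContinuousLinearMap.snd ℝ Pk Pq)
      ((hφat y hy).mdifferentiableAt (by simp)) v
    exact Eq.congr (h2.symm.trans h1) rfl
  -- In the chart `φ` these coordinates have an invertible derivative.
  set V : Set (Pk × Pq) := φ.target ∩ φ.symm ⁻¹' U with hV
  have hfs : ∀ z ∈ V, ContDiffAt ℝ ∞ (Φ ∘ φ.symm) z := fun z hz =>
    contMDiffAt_iff_contDiffAt.1 ((hΦs _ hz.2).comp z
      ((hφs' z hz.1).contMDiffAt (φ.open_target.mem_nhds hz.1)))
  have hfd : ∀ z ∈ V, ∃ f' : (Pk × Pq) ≃L[ℝ] (Pk × Pq),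
      HasFDerivAt (Φ ∘ φ.symm) (f' : (Pk × Pq) →L[ℝ] (Pk × Pq)) z := by
    intro z hz
    have h1 := ((hfs z hz).differentiableAt (by simp)).hasFDerivAt
    have h2 : ∀ w, fderiv ℝ (Φ ∘ φ.symm) z w = (mfderiv 𝓘(ℝ, E) 𝓘(ℝ, Pk × Pq) Φ (φ.symm z)
        (mfderiv 𝓘(ℝ, Pk × Pq) 𝓘(ℝ, E) φ.symm z w) : Pk × Pq) := fun w => by
      rw [← mfderiv_eq_fderiv, mfderiv_comp z (hΦd _ hz.2) (hφ.mdifferentiableAt_symm hz.1)]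
      rfl
    have hinj : Function.Injective (fderiv ℝ (Φ ∘ φ.symm) z : (Pk × Pq) →ₗ[ℝ] (Pk × Pq)) := by
      refine (injective_iff_map_eq_zero _).2 fun w hw => ?_
      have h3 := (h2 w).symm.trans hw
      have h4 := hFG (φ.symm z) _ ((hΦ2 _ hz.2 _).2 (congrArg Prod.snd h3))
        ((hΦ1 _ hz.2 _).2 (congrArg Prod.fst h3))
      exact (hφ.symm.mfderiv hz.1).injective (h4.trans (map_zero _).symm)
    refine ⟨(LinearEquiv.ofInjectiveEndo _ hinj).toContinuousLinearEquiv, ?_⟩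
    exact h1
  have hzV : φ x ∈ V := ⟨φ.map_source hx, by
    rw [mem_preimage, φ.left_inv hx]; exact ⟨hx, hxψ⟩⟩
  have hVo : IsOpen V := φ.symm.isOpen_inter_preimage hUo
  obtain ⟨f', hf'⟩ := hfd _ hzV
  set e := (hfs _ hzV).toOpenPartialHomeomorph _ hf' (by simp) with he
  have hecoe : (e : Pk × Pq → Pk × Pq) = Φ ∘ φ.symm := rfl
  have hze : φ x ∈ e.source := (hfs _ hzV).mem_toOpenPartialHomeomorph_source hf' (by simp)
  set χ := φ.trans (e.restrOpen V hVo) with hχ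
  have hχx : x ∈ χ.source := by
    simp only [hχ, OpenPartialHomeomorph.trans_source, OpenPartialHomeomorph.restrOpen_source]
    exact ⟨hx, hze, hzV⟩
  have hχU : ∀ y ∈ χ.source, y ∈ U := fun y hy => by
    simp only [hχ, OpenPartialHomeomorph.trans_source, OpenPartialHomeomorph.restrOpen_source] at hy
    have := hy.2.2.2
    rwa [mem_preimage, φ.left_inv hy.1] at this
  have hχΦ : ∀ y ∈ χ.source, χ y = Φ y := fun y hy => by
    change Φ (φ.symm (φ y)) = Φ y
    rw [φ.left_inv (hχU y hy).1]
  have hχΦ' : ∀ y ∈ χ.source, χ =ᶠ[𝓝 y] Φ := fun y hy =>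
    Filter.eventuallyEq_of_mem (χ.open_source.mem_nhds hy) hχΦ
  have hχs' : ∀ z ∈ χ.target, ContMDiffAt 𝓘(ℝ, Pk × Pq) 𝓘(ℝ, E) ∞ χ.symm z := by
    intro z hz
    have hz' := hz
    simp only [hχ, OpenPartialHomeomorph.trans_target] at hz'
    have h1 : (e.restrOpen V hVo).symm z ∈ V := by
      have := (e.restrOpen V hVo).map_target hz'.1
      rw [OpenPartialHomeomorph.restrOpen_source] at this
      exact this.2
    obtain ⟨g', hg'⟩ := hfd _ h1
    have h2 : ContDiffAt ℝ ∞ (e.restrOpen V hVo).symm z :=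
      (e.restrOpen V hVo).contDiffAt_symm hz'.1 hg' (hfs _ h1)
    exact ((hφs' _ h1.1).contMDiffAt (φ.open_target.mem_nhds h1.1)).comp z h2.contMDiffAt
  obtain ⟨r, hr, hball⟩ := Metric.isOpen_iff.1 χ.open_target (χ x) (χ.map_source hχx)
  rw [← ball_prod_same] at hball
  set A := Metric.ball (χ x).1 r
  set B := Metric.ball (χ x).2 r
  have hAB : IsOpen (A ×ˢ B) := Metric.isOpen_ball.prod Metric.isOpen_ball
  set ρ := χ.trans (OpenPartialHomeomorph.ofSet (A ×ˢ B) hAB) with hρ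
  have hsrc : ρ.source ⊆ χ.source := fun y hy => by
    rw [hρ, OpenPartialHomeomorph.trans_source] at hy
    exact hy.1
  have htar : ρ.target = A ×ˢ B := by
    rw [hρ, OpenPartialHomeomorph.trans_target]
    exact inter_eq_left.2 hball
  refine ⟨ρ, A, B, ?_, Metric.isOpen_ball, Metric.isOpen_ball, convex_ball _ _, convex_ball _ _,
    htar, fun y hy => ?_, fun z hz => ?_, fun y hy v => ?_⟩
  · rw [hρ, OpenPartialHomeomorph.trans_source]
    exact ⟨hχx, Metric.mem_ball_self hr, Metric.mem_ball_self hr⟩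
  · exact ((hΦs y (hχU y (hsrc hy))).congr_of_eventuallyEq (hχΦ' y (hsrc hy))).contMDiffWithinAt
  · rw [htar] at hz
    exact (hχs' z (hball hz)).contMDiffWithinAt
  · have h1 : mfderiv 𝓘(ℝ, E) 𝓘(ℝ, Pk × Pq) ρ y = mfderiv 𝓘(ℝ, E) 𝓘(ℝ, Pk × Pq) Φ y :=
      (hχΦ' y (hsrc hy)).mfderiv_eq
    rw [h1]
    exact ⟨hΦ2 y (hχU y (hsrc hy)) v, hΦ1 y (hχU y (hsrc hy)) v⟩

end ProductCharts

/-! ### The product metric -/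

section ProductMetric

open Set VectorField

variable {E : Type*} [NormedAddCommGroup E] [NormedSpace ℝ E] [FiniteDimensional ℝ E]
  {M : Type*} [TopologicalSpace M] [ChartedSpace E M] [IsManifold 𝓘(ℝ, E) ∞ M]
  [Bundle.RiemannianBundle (fun x : M => TangentSpace 𝓘(ℝ, E) x)]
  [IsContMDiffRiemannianBundle 𝓘(ℝ, E) ∞ E (fun x : M => TangentSpace 𝓘(ℝ, E) x)]
  {k q : ℕ} {x : M} {F : Foliation E M k q} {G : Foliation E M q k}

namespace Foliation

/-- If the leaves of `F` are totally geodesic, the length of a field tangent to `F` is constant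
along the commuting fields normal to `F`: if `[X, Y] = 0`, then
`Y |X|² = 2 ⟨∇_X Y, X⟩ = -2 ⟨Y, ∇_X X⟩ = 0`. -/
theorem IsTotallyGeodesic.mvfderiv_inner_self (hF : F.IsTotallyGeodesic)
    {X Y : Π x : M, TangentSpace 𝓘(ℝ, E) x} (hX : SmoothFieldAt X x) (hY : SmoothFieldAt Y x)
    (hXF : ∀ᶠ y in 𝓝 x, X y ∈ F.tangent y) (hYF : ∀ᶠ y in 𝓝 x, Y y ∈ (F.tangent y)ᗮ)
    (hXY : mlieBracket 𝓘(ℝ, E) X Y x = 0) :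
    mvfderiv 𝓘(ℝ, E) (fun y => (inner ℝ (X y) (X y) : ℝ)) x (Y x) = 0 := by
  have hXd := hX.mdifferentiableAt
  have hYd := hY.mdifferentiableAt
  have h1 : leviCivita X x (Y x) = leviCivita Y x (X x) := by
    have := leviCivita_sub_leviCivita hXd hYd
    rw [hXY] at this
    exact (sub_eq_zero.1 this).symm
  have h2 : ∀ᶠ y in 𝓝 x, (inner ℝ (Y y) (X y) : ℝ) = 0 := by
    filter_upwards [hXF, hYF] with y h3 h4
    rw [real_inner_comm]
    exact h4 _ h3
  have h3 : (inner ℝ (leviCivita X x (X x)) (Y x) : ℝ) = 0 := by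
    rw [← F.inner_secondFundamentalForm hXd hXF _ hYF.self_of_nhds,
      hF x _ hXF.self_of_nhds _ hXF.self_of_nhds, inner_zero_left]
  have h4 : (inner ℝ (leviCivita X x (Y x)) (X x) : ℝ) = 0 := by
    rw [h1, inner_leviCivita_eq_neg hYd hXd h2, real_inner_comm, h3, neg_zero]
  rw [mvfderiv_inner hXd hXd, real_inner_comm (leviCivita X x (Y x)) (X x), h4, add_zero]

/-- In a chart adapted to a totally geodesic foliation and its orthogonal complement, the metric
coefficients along the leaves do not depend on the transverse coordinates. -/
theorem IsTotallyGeodesic.norm_mfderiv_symm_eq (hF : F.IsTotallyGeodesic) {P : Type*}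
    [NormedAddCommGroup P] [NormedSpace ℝ P] [FiniteDimensional ℝ P] {φ : OpenPartialHomeomorph M P}
    (hφs : ContMDiffOn 𝓘(ℝ, E) 𝓘(ℝ, P) ∞ φ φ.source)
    (hφs' : ContMDiffOn 𝓘(ℝ, P) 𝓘(ℝ, E) ∞ φ.symm φ.target) {w₁ w₂ z : P}
    (h1 : ∀ z ∈ φ.target, mfderiv 𝓘(ℝ, P) 𝓘(ℝ, E) φ.symm z w₁ ∈ F.tangent (φ.symm z))
    (h2 : ∀ z ∈ φ.target, mfderiv 𝓘(ℝ, P) 𝓘(ℝ, E) φ.symm z w₂ ∈ (F.tangent (φ.symm z))ᗮ)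
    (hseg : ∀ t ∈ Icc (0 : ℝ) 1, z + t • w₂ ∈ φ.target) :
    ‖mfderiv 𝓘(ℝ, P) 𝓘(ℝ, E) φ.symm (z + w₂) w₁‖ = ‖mfderiv 𝓘(ℝ, P) 𝓘(ℝ, E) φ.symm z w₁‖ := by
  have : CompleteSpace P := FiniteDimensional.complete ℝ P
  have hφ : φ.MDifferentiable 𝓘(ℝ, E) 𝓘(ℝ, P) :=
    ⟨hφs.mdifferentiableOn (by simp), hφs'.mdifferentiableOn (by simp)⟩
  set X : P → Π x : M, TangentSpace 𝓘(ℝ, E) x := fun w =>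
    mpullback 𝓘(ℝ, E) 𝓘(ℝ, P) φ (constField w) with hX
  have hXs : ∀ w, ∀ y ∈ φ.source, SmoothFieldAt (X w) y := fun w y hy =>
    ContMDiffAt.mpullback_vectorField_preimage (n := ∞)
      (contMDiffAt_vectorSpace_iff_contDiffAt.2 contDiffAt_const)
      ((hφs y hy).contMDiffAt (φ.open_source.mem_nhds hy)) ⟨hφ.mfderiv hy, rfl⟩ (by simp)
  have hXz : ∀ w, ∀ z ∈ φ.target, X w (φ.symm z) = mfderiv 𝓘(ℝ, P) 𝓘(ℝ, E) φ.symm z w := by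
    intro w z hz
    refine (hφ.mfderiv (φ.map_target hz)).injective ?_
    refine (congrArg (hφ.mfderiv (φ.map_target hz))
      (mpullback_eq_mfderiv_symm hφ (φ.map_target hz) (constField w))).trans ?_
    refine ((hφ.mfderiv (φ.map_target hz)).apply_symm_apply _).trans ?_
    exact (DFunLike.congr_fun (hφ.comp_symm_deriv hz) w).symm
  have hXF : ∀ y ∈ φ.source, X w₁ y ∈ F.tangent y := fun y hy => by
    have := h1 _ (φ.map_source hy)
    rwa [← hXz _ _ (φ.map_source hy), φ.left_inv hy] at this
  have hYF : ∀ y ∈ φ.source, X w₂ y ∈ (F.tangent y)ᗮ := fun y hy => by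
    have := h2 _ (φ.map_source hy)
    rwa [← hXz _ _ (φ.map_source hy), φ.left_inv hy] at this
  have hbr : ∀ y ∈ φ.source, mlieBracket 𝓘(ℝ, E) (X w₁) (X w₂) y = 0 := by
    intro y hy
    have hmin : minSmoothness ℝ 2 ≤ (∞ : WithTop ℕ∞) := by
      rw [minSmoothness_of_isRCLikeNormedField]; exact ENat.LEInfty.out
    have : IsManifold 𝓘(ℝ, E) (minSmoothness ℝ 2) M := .of_le hmin
    have hc : ∀ w : P, MDifferentiableAt 𝓘(ℝ, P) (𝓘(ℝ, P).prod 𝓘(ℝ, P)) (T% (constField w))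
        (φ y) := fun w =>
      (contMDiffAt_vectorSpace_iff_contDiffAt (n := 1).2 contDiffAt_const).mdifferentiableAt
        (by simp)
    rw [hX, ← mpullback_mlieBracket (n := ∞) (hc _) (hc _)
      ((hφs y hy).contMDiffAt (φ.open_source.mem_nhds hy)) hmin,
      mpullback_eq_mfderiv_symm hφ hy]
    refine (congrArg (hφ.mfderiv hy).symm ?_).trans (map_zero _)
    rw [mlieBracket_eq_fderiv_sub]
    exact (by simp : (fderiv ℝ (fun _ : P => w₂) (φ y) w₁ - fderiv ℝ (fun _ : P => w₁) (φ y) w₂ : P)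
      = 0)
  have hsrc : ∀ y ∈ φ.source, ∀ᶠ y' in 𝓝 y, y' ∈ φ.source := fun y hy =>
    φ.open_source.mem_nhds hy
  set g : M → ℝ := fun y => inner ℝ (X w₁ y) (X w₁ y) with hg
  have hline : ∀ t : ℝ, HasDerivAt (fun t : ℝ => z + t • w₂) w₂ t := fun t => by
    simpa using ((hasDerivAt_id t).smul_const w₂).const_add z
  have hder : ∀ t ∈ Icc (0 : ℝ) 1, HasDerivAt (g ∘ φ.symm ∘ fun t : ℝ => z + t • w₂) 0 t := by
    intro t ht
    have hzt := hseg t ht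
    have hyt := φ.map_target hzt
    have h3 : HasMFDerivAt 𝓘(ℝ, ℝ) 𝓘(ℝ, E) (φ.symm ∘ fun t : ℝ => z + t • w₂) t
        ((1 : ℝ →L[ℝ] ℝ).smulRight (X w₂ (φ.symm (z + t • w₂)))) := by
      refine ((hφ.mdifferentiableAt_symm hzt).hasMFDerivAt.comp t
        (hasMFDerivAt_iff_hasFDerivAt.2 (hline t).hasFDerivAt)).congr_mfderiv
        (ContinuousLinearMap.ext_ring ?_)
      rw [hXz _ _ hzt]
      refine Eq.trans ?_ (one_smul ℝ (mfderiv 𝓘(ℝ, P) 𝓘(ℝ, E) φ.symm (z + t • w₂) w₂)).symm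
      exact congrArg (mfderiv 𝓘(ℝ, P) 𝓘(ℝ, E) φ.symm (z + t • w₂)) (one_smul ℝ w₂)
    have h4 := h3.hasDerivAt_comp (f := g) (mdifferentiableAt_inner (hXs w₁ _ hyt).mdifferentiableAt
      (hXs w₁ _ hyt).mdifferentiableAt)
    refine h4.congr_deriv ?_
    exact hF.mvfderiv_inner_self (hXs w₁ _ hyt) (hXs w₂ _ hyt) ((hsrc _ hyt).mono hXF)
      ((hsrc _ hyt).mono hYF) (hbr _ hyt)
  have h5 := constant_of_has_deriv_right_zero
    (fun t ht => (hder t ht).continuousAt.continuousWithinAt)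
    (fun t ht => (hder t (Ico_subset_Icc_self ht)).hasDerivWithinAt) 1 ⟨zero_le_one, le_rfl⟩
  obtain ⟨m, hm⟩ : ∃ m : P → ℝ, ∀ z, m z = ‖mfderiv 𝓘(ℝ, P) 𝓘(ℝ, E) φ.symm z w₁‖ :=
    ⟨_, fun _ => rfl⟩
  have hgm : ∀ t ∈ Icc (0 : ℝ) 1, (g ∘ φ.symm ∘ fun t : ℝ => z + t • w₂) t = m (z + t • w₂) ^ 2 :=
    fun t ht => by
      simp only [Function.comp_apply, hg]
      rw [real_inner_self_eq_norm_sq, hXz _ _ (hseg t ht), hm]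
  rw [hgm 0 ⟨le_rfl, zero_le_one⟩, hgm 1 ⟨zero_le_one, le_rfl⟩, one_smul, zero_smul, add_zero,
    pow_left_inj₀ (hm _ ▸ norm_nonneg _) (hm _ ▸ norm_nonneg _) two_ne_zero, hm, hm] at h5
  exact h5

/-- Two orthogonal totally geodesic foliations split the manifold locally as a Riemannian
product. -/
theorem isLocallyRiemannianProduct (horth : ∀ x : M, G.tangent x = (F.tangent x)ᗮ)
    (hF : F.IsTotallyGeodesic) (hG : G.IsTotallyGeodesic) : F.IsLocallyRiemannianProduct G := by
  intro x
  set Pk := EuclideanSpace ℝ (Fin k)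
  set Pq := EuclideanSpace ℝ (Fin q)
  obtain ⟨φ, A, B, hx, hA, hB, hAc, hBc, hT, hφs, hφs', hφ⟩ := F.exists_product_chart G
    (fun y v hv hv' => by
      rw [horth] at hv'
      exact inner_self_eq_zero (𝕜 := ℝ).1 (hv' v hv)) x
  have hφd : φ.MDifferentiable 𝓘(ℝ, E) 𝓘(ℝ, Pk × Pq) :=
    ⟨hφs.mdifferentiableOn (by simp), hφs'.mdifferentiableOn (by simp)⟩
  have hxT : φ x ∈ A ×ˢ B := by rw [← hT]; exact φ.map_source hx
  have hGF : ∀ y, F.tangent y = (G.tangent y)ᗮ := fun y => by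
    rw [horth, Submodule.orthogonal_orthogonal]
  have hDF : ∀ (u : Pk), ∀ z ∈ φ.target,
      mfderiv 𝓘(ℝ, Pk × Pq) 𝓘(ℝ, E) φ.symm z (u, 0) ∈ F.tangent (φ.symm z) := fun u z hz =>
    ((hφ _ (φ.map_target hz) _).1).2
      (congrArg Prod.snd (DFunLike.congr_fun (hφd.comp_symm_deriv hz) (u, 0)))
  have hDG : ∀ (v : Pq), ∀ z ∈ φ.target,
      mfderiv 𝓘(ℝ, Pk × Pq) 𝓘(ℝ, E) φ.symm z (0, v) ∈ G.tangent (φ.symm z) := fun v z hz =>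
    ((hφ _ (φ.map_target hz) _).2).2
      (congrArg Prod.fst (DFunLike.congr_fun (hφd.comp_symm_deriv hz) (0, v)))
  have hsegA : ∀ a ∈ A, ∀ a' ∈ A, ∀ b ∈ B, ∀ t ∈ Icc (0 : ℝ) 1,
      ((a, b) : Pk × Pq) + t • (a' - a, 0) ∈ φ.target := fun a ha a' ha' b hb t ht => by
    rw [hT]
    refine ⟨hAc.add_smul_sub_mem ha ha' ht, ?_⟩
    simpa using hb
  have hsegB : ∀ a ∈ A, ∀ b ∈ B, ∀ b' ∈ B, ∀ t ∈ Icc (0 : ℝ) 1,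
      ((a, b) : Pk × Pq) + t • (0, b' - b) ∈ φ.target := fun a ha b hb b' hb' t ht => by
    rw [hT]
    refine ⟨?_, hBc.add_smul_sub_mem hb hb' ht⟩
    simpa using ha
  refine ⟨φ, A, B, (φ x).1, (φ x).2, hx, rfl, hA, hB, hT, hφs, hφs', fun a ha b hb =>
    ⟨?_, ?_, fun u v => ?_⟩⟩
  · have := F.mem_leaf_of_segment φ.open_target hφs' (z := ((φ x).1, b)) (w := (a - (φ x).1, 0))
      (τ := 1) (fun t ht => hDF _ _ ht)
      (by rw [uIcc_of_le zero_le_one]; exact hsegA _ hxT.1 _ ha _ hb)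
    simpa using this
  · have := G.mem_leaf_of_segment φ.open_target hφs' (z := (a, (φ x).2)) (w := (0, b - (φ x).2))
      (τ := 1) (fun t ht => hDG _ _ ht)
      (by rw [uIcc_of_le zero_le_one]; exact hsegB _ ha _ hxT.2 _ hb)
    simpa using this
  · have hz : (a, b) ∈ φ.target := hT ▸ ⟨ha, hb⟩
    refine ⟨hDF u _ hz, hDG v _ hz, ?_⟩
    have h1 : ‖mfderiv 𝓘(ℝ, Pk × Pq) 𝓘(ℝ, E) φ.symm (a, b) (u, 0)‖
        = ‖mfderiv 𝓘(ℝ, Pk × Pq) 𝓘(ℝ, E) φ.symm (a, (φ x).2) (u, 0)‖ := by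
      have := hF.norm_mfderiv_symm_eq hφs hφs' (w₁ := (u, 0)) (z := (a, (φ x).2))
        (w₂ := (0, b - (φ x).2)) (hDF u) (fun z hz => horth _ ▸ hDG _ z hz)
        (hsegB _ ha _ hxT.2 _ hb)
      rwa [show ((a, (φ x).2) + (0, b - (φ x).2) : Pk × Pq) = (a, b) by simp] at this
    have h2 : ‖mfderiv 𝓘(ℝ, Pk × Pq) 𝓘(ℝ, E) φ.symm (a, b) (0, v)‖
        = ‖mfderiv 𝓘(ℝ, Pk × Pq) 𝓘(ℝ, E) φ.symm ((φ x).1, b) (0, v)‖ := by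
      have := hG.norm_mfderiv_symm_eq hφs hφs' (w₁ := (0, v)) (z := ((φ x).1, b))
        (w₂ := (a - (φ x).1, 0)) (hDG v) (fun z hz => hGF _ ▸ hDF _ z hz)
        (hsegA _ hxT.1 _ ha _ hb)
      rwa [show (((φ x).1, b) + (a - (φ x).1, 0) : Pk × Pq) = (a, b) by simp] at this
    have h3 : mfderiv 𝓘(ℝ, Pk × Pq) 𝓘(ℝ, E) φ.symm (a, b) (u, v)
        = mfderiv 𝓘(ℝ, Pk × Pq) 𝓘(ℝ, E) φ.symm (a, b) (u, 0)
          + mfderiv 𝓘(ℝ, Pk × Pq) 𝓘(ℝ, E) φ.symm (a, b) (0, v) :=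
      (congrArg (mfderiv 𝓘(ℝ, Pk × Pq) 𝓘(ℝ, E) φ.symm (a, b))
        (show ((u, v) : Pk × Pq) = (u, 0) + (0, v) by simp)).trans (map_add _ _ _)
    have h4 : (inner ℝ (mfderiv 𝓘(ℝ, Pk × Pq) 𝓘(ℝ, E) φ.symm (a, b) (u, 0))
        (mfderiv 𝓘(ℝ, Pk × Pq) 𝓘(ℝ, E) φ.symm (a, b) (0, v)) : ℝ) = 0 := by
      have := hDG v _ hz
      rw [horth] at this
      exact this _ (hDF u _ hz)
    rw [← h1, ← h2]
    refine (congrArg (fun w => ‖w‖ ^ 2) h3).trans ?_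
    rw [norm_add_sq_real, h4, mul_zero, add_zero]

end Foliation

end ProductMetric

/-! ### Rigidity of orthogonal foliations in constant curvature -/

theorem theorem4 (n p : ℕ) (hn : 1 ≤ n)
    (M : Type*) [EMetricSpace M] [ChartedSpace (EuclideanSpace ℝ (Fin (n + p))) M]
    [IsManifold 𝓘(ℝ, EuclideanSpace ℝ (Fin (n + p))) ∞ M]
    [Bundle.RiemannianBundle
      (fun x : M => TangentSpace 𝓘(ℝ, EuclideanSpace ℝ (Fin (n + p))) x)]
    [IsContMDiffRiemannianBundle 𝓘(ℝ, EuclideanSpace ℝ (Fin (n + p))) ∞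
      (EuclideanSpace ℝ (Fin (n + p)))
      (fun x : M => TangentSpace 𝓘(ℝ, EuclideanSpace ℝ (Fin (n + p))) x)]
    [IsRiemannianManifold 𝓘(ℝ, EuclideanSpace ℝ (Fin (n + p))) M]
    [CompleteSpace M]
    (c : ℝ) (hc : 0 ≤ c)
    (hcurv : HasConstantCurvature (EuclideanSpace ℝ (Fin (n + p))) M c)
    (F : Foliation (EuclideanSpace ℝ (Fin (n + p))) M n p)
    (G : Foliation (EuclideanSpace ℝ (Fin (n + p))) M p n)
    (horth : ∀ x : M, G.tangent x = (F.tangent x)ᗮ)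
    (humb : (2 ≤ p ∧ G.IsTotallyUmbilical) ∨ (p = 1 ∧ G.IsByRoundCircles))
    (hbdd : ∃ C : ℝ, ∀ x : M, ‖G.meanCurvature x‖ ≤ C)
    (x₀ : M) (hmax : ∀ y : M, ‖G.meanCurvature y‖ ≤ ‖G.meanCurvature x₀‖)
    (hdiv : ∀ x ∈ G.leaf x₀, F.divergence G.meanCurvature x ≤ n * c) :
    c = 0 ∧ F.IsTotallyGeodesic ∧ G.IsTotallyGeodesic ∧ F.IsLocallyRiemannianProduct G := by
  have hG : G.IsTotallyUmbilical := by
    rcases humb with h | ⟨rfl, -⟩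
    · exact h.2
    · exact G.isTotallyUmbilical_of_dim_one
  have hp : 0 < p := by
    rcases humb with h | h <;> omega
  obtain ⟨h1, h2, h3⟩ :=
    Foliation.totallyGeodesic_of_divergence_le hc hcurv horth hG hn hp hmax hdiv
  exact ⟨h1, h2, h3, Foliation.isLocallyRiemannianProduct horth h2 h3⟩
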